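/- A multi-agent contract setting with $n \ge 0$ agents is a pair $(f,c)$, where $f:2^{[n]}\to\mathbb{R}_{\ge 0}$ is monotone with $f(\emptyset)=0$, and $c=(c_1,\dots,c_n)$ are individual costs with $0<c_i\le f(\{i\})$ for every $i$; write $c(S)=\sum_{i\in S}c_i$. The value function $f$ is XOS if $f(S)=\max_{\ell}w_\ell(S)$ for a finite family of additive functions $w_\ell$ with nonnegative weights. For $i\in S$ the marginal contribution is $f(i:S)=f(S)-f(S\setminus\{i\})$; the total share needed to incentivize $S$ is $\rho(S)=\sum_{i\in S}c_i/f(i:S)$ (equal to $\infty$ if some marginal is $0$), and $S$ is feasible if $\rho(S)\le 1$. The welfare of $S$ is $w(S)=f(S)-c(S)$, the principal's utility is $g(S)=(1-\rho(S))f(S)$, and $OPT(w)$ is the maximum of $w(S)$ over all feasible $S$. For $a\in(0,1]$, an $a$-demand oracle for $f$ takes a vector $p\in\mathbb{R}_{\ge 0}^n$ and returns a set $D$ with $f(D)-p(D)\ge a\,f(T)-p(T)$ for every $T\subseteq[n]$, where $p(S)=\sum_{i\in S}p_i$; for $a=1$ it is an exact demand oracle. A value oracle takes a set $S$ and returns $f(S)$.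 **Theorem.** There are constants $C(a)>0$, $a\in(0,1]$, depending only on $a$, with $C(1)=188$, a polynomial $T$, and a single algorithm with the following property. For every $a\in(0,1]$, every $n$, every $n$-agent setting $(f,c)$ with $f$ XOS, and every $a$-demand oracle for $f$: given $n$, $a$, $c_1,\dots,c_n$ and access to a value oracle for $f$ and to the $a$-demand oracle, the algorithm halts within $T(n)$ steps and outputs a feasible set $U\subseteq[n]$ with $$OPT(w)\;\le\; C(a)\cdot g(U).$$ Here an algorithm is a finite program for a real random access machine with rational constants; its steps are $+,-,\times,\div,\sqrt{\cdot}$ and comparisons on reals, addition, subtraction and comparisons on integers, and reading and writing memory cells, each at unit cost, and oracle calls at cost $n+1$. -/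

import Mathlib

open scoped ENNReal

noncomputable section

/-! ## Multi-agent contract settings -/

/-- The additive set function with weights `c`. -/
def additiveCost {n : ℕ} (c : Fin n → ℝ) (S : Finset (Fin n)) : ℝ := ∑ i ∈ S, c i

/-- `f` is XOS: the pointwise maximum of a finite family of additive functions
with nonnegative weights. -/
def IsXOS {n : ℕ} (f : Finset (Fin n) → ℝ) : Prop :=
  ∃ (k : ℕ) (w : Fin k → Fin n → ℝ), (∀ l i, 0 ≤ w l i) ∧
    ∀ S, IsGreatest (Set.range fun l => additiveCost (w l) S) (f S)

/-- A multi-agent contract setting with `n` agents: a monotone value function with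
`f ∅ = 0` (hence nonnegative), and strictly positive individual costs,
each bounded by the value of the agent working alone (hence that value is positive). -/
structure ContractSetting (n : ℕ) where
  f : Finset (Fin n) → ℝ
  c : Fin n → ℝ
  f_empty : f ∅ = 0
  f_mono : ∀ S T, S ⊆ T → f S ≤ f T
  c_pos : ∀ i, 0 < c i
  c_le : ∀ i, c i ≤ f {i}

namespace ContractSetting

variable {n : ℕ} (I : ContractSetting n)

/-- The marginal contribution `f(i : S) = f(S ∪ {i}) - f(S \ {i})`. -/
def marginal (i : Fin n) (S : Finset (Fin n)) : ℝ := I.f (insert i S) - I.f (S.erase i)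

/-- The welfare `w(S) = f(S) - c(S)`. -/
def welfare (S : Finset (Fin n)) : ℝ := I.f S - additiveCost I.c S

/-- The minimum share `c_i / f(i : S)` that incentivizes agent `i` of the team `S`.
It is `∞` (no share suffices) if the marginal is zero, since costs are positive. -/
def share (i : Fin n) (S : Finset (Fin n)) : ℝ≥0∞ :=
  ENNReal.ofReal (I.c i) / ENNReal.ofReal (I.marginal i S)

/-- The minimum total share `ρ(S)` that incentivizes the team `S`. -/
def totalShare (S : Finset (Fin n)) : ℝ≥0∞ := ∑ i ∈ S, I.share i S

/-- A team is feasible (budget-balanced) if `ρ(S) ≤ 1`. -/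
def Feasible (S : Finset (Fin n)) : Prop := I.totalShare S ≤ 1

/-- The principal's utility `g(S) = (1 - ρ(S)) f(S)`; it is `-∞` for a team that no
contract incentivizes. -/
def utility (S : Finset (Fin n)) : EReal := (1 - (I.totalShare S : EReal)) * (I.f S : EReal)

theorem feasible_empty : I.Feasible ∅ := by simp [Feasible, totalShare]

open scoped Classical in
/-- The optimal welfare over all feasible teams. -/
def optWelfare : ℝ :=
  (Finset.univ.filter fun S => I.Feasible S).sup'
    ⟨∅, Finset.mem_filter.2 ⟨Finset.mem_univ _, I.feasible_empty⟩⟩ I.welfare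

end ContractSetting

/-- `D` is an `a`-demand oracle for `f`: on every vector `p` of nonnegative prices it
returns a set `D p` with `f(D p) - p(D p) ≥ a f(T) - p(T)` for every `T`. For `a = 1`
this is an exact demand oracle. -/
def IsDemandOracle {n : ℕ} (a : ℝ) (f : Finset (Fin n) → ℝ)
    (D : (Fin n → ℝ) → Finset (Fin n)) : Prop :=
  ∀ p : Fin n → ℝ, (∀ i, 0 ≤ p i) → ∀ T,
    a * f T - additiveCost p T ≤ f (D p) - additiveCost p (D p)

/-! ## Real random access programs with oracles and a step count

Programs are finite objects (their only real constants are rational) that do not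
depend on the number of agents. Memory: integer counters, real arrays, and bit arrays
(a bit array is represented by the set of its positions holding `1`). There is no
multiplication of integers and no rounding of reals, so that a unit charge per elementary
operation is a realistic measure. -/

namespace RealRAM

/-- The memory: counters `nat v`, real arrays with cells `real r k`, bit arrays `bits x`. -/
structure Store where
  nat : ℕ → ℕ
  real : ℕ → ℕ → ℝ
  bits : ℕ → Finset ℕ

/-- What a program can query: a value oracle and a demand oracle over `n` agents. -/
structure Oracles (n : ℕ) where
  value : Finset (Fin n) → ℝ
  demand : (Fin n → ℝ) → Finset (Fin n)

/-- Integer expressions; `sub` is truncated subtraction. -/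
inductive NExpr where
  | const (k : ℕ)
  | var (v : ℕ)
  | add (e₁ e₂ : NExpr)
  | sub (e₁ e₂ : NExpr)

/-- Real expressions; `cell r e` is the cell of the real array `r` at index `e`. -/
inductive RExpr where
  | const (q : ℚ)
  | cell (r : ℕ) (e : NExpr)
  | add (e₁ e₂ : RExpr)
  | sub (e₁ e₂ : RExpr)
  | mul (e₁ e₂ : RExpr)
  | div (e₁ e₂ : RExpr)
  | sqrt (e : RExpr)

/-- Tests; `mem e x` reads the bit of the bit array `x` at index `e`. -/
inductive BExpr where
  | natLe (e₁ e₂ : NExpr)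
  | realLe (e₁ e₂ : RExpr)
  | mem (e : NExpr) (x : ℕ)
  | not (b : BExpr)
  | and (b₁ b₂ : BExpr)

/-- Structured programs. `setBit` and `clearBit` write one bit of a bit array.
`queryValue x r e` asks the value oracle for the set in the bit array `x` and writes
the answer into cell `e` of the real array `r`. `queryDemand r x` asks the demand
oracle at the prices in cells `0, …, n - 1` of `r` and writes the answer into `x`. -/
inductive Prog where
  | skip
  | setNat (v : ℕ) (e : NExpr)
  | setReal (r : ℕ) (i : NExpr) (e : RExpr)
  | setBit (x : ℕ) (i : NExpr)
  | clearBit (x : ℕ) (i : NExpr)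
  | queryValue (x : ℕ) (r : ℕ) (i : NExpr)
  | queryDemand (r : ℕ) (x : ℕ)
  | seq (P Q : Prog)
  | ite (b : BExpr) (P Q : Prog)
  | while (b : BExpr) (P : Prog)

/-- Value of an integer expression. -/
def NExpr.eval (s : Store) : NExpr → ℕ
  | const k => k
  | var v => s.nat v
  | add e₁ e₂ => e₁.eval s + e₂.eval s
  | sub e₁ e₂ => e₁.eval s - e₂.eval s

/-- Number of elementary operations in evaluating an integer expression. -/
def NExpr.cost : NExpr → ℕ
  | const _ => 1
  | var _ => 1
  | add e₁ e₂ => e₁.cost + e₂.cost + 1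
  | sub e₁ e₂ => e₁.cost + e₂.cost + 1

/-- Value of a real expression (division by zero and roots of negative numbers give `0`). -/
def RExpr.eval (s : Store) : RExpr → ℝ
  | const q => (q : ℝ)
  | cell r e => s.real r (e.eval s)
  | add e₁ e₂ => e₁.eval s + e₂.eval s
  | sub e₁ e₂ => e₁.eval s - e₂.eval s
  | mul e₁ e₂ => e₁.eval s * e₂.eval s
  | div e₁ e₂ => e₁.eval s / e₂.eval s
  | sqrt e => Real.sqrt (e.eval s)

/-- Number of elementary operations in evaluating a real expression. -/
def RExpr.cost : RExpr → ℕ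
  | const _ => 1
  | cell _ e => e.cost + 1
  | add e₁ e₂ => e₁.cost + e₂.cost + 1
  | sub e₁ e₂ => e₁.cost + e₂.cost + 1
  | mul e₁ e₂ => e₁.cost + e₂.cost + 1
  | div e₁ e₂ => e₁.cost + e₂.cost + 1
  | sqrt e => e.cost + 1

/-- Truth of a test. -/
def BExpr.Holds (s : Store) : BExpr → Prop
  | natLe e₁ e₂ => e₁.eval s ≤ e₂.eval s
  | realLe e₁ e₂ => e₁.eval s ≤ e₂.eval s
  | mem e x => e.eval s ∈ s.bits x
  | not b => ¬ b.Holds s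
  | and b₁ b₂ => b₁.Holds s ∧ b₂.Holds s

/-- Number of elementary operations in evaluating a test. -/
def BExpr.cost : BExpr → ℕ
  | natLe e₁ e₂ => e₁.cost + e₂.cost + 1
  | realLe e₁ e₂ => e₁.cost + e₂.cost + 1
  | mem e _ => e.cost + 1
  | not b => b.cost + 1
  | and b₁ b₂ => b₁.cost + b₂.cost + 1

namespace Store

/-- Overwrite a counter. -/
def setNat (s : Store) (v k : ℕ) : Store := { s with nat := Function.update s.nat v k }

/-- Overwrite one cell of a real array. -/
def setReal (s : Store) (r i : ℕ) (x : ℝ) : Store :=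
  { s with real := Function.update s.real r (Function.update (s.real r) i x) }

/-- Overwrite a bit array. -/
def setBits (s : Store) (x : ℕ) (X : Finset ℕ) : Store :=
  { s with bits := Function.update s.bits x X }

/-- The set of agents described by the bit array `x`. -/
def agents (s : Store) (n x : ℕ) : Finset (Fin n) :=
  Finset.univ.filter fun i => (i : ℕ) ∈ s.bits x

/-- The vector in cells `0, …, n - 1` of the real array `r`. -/
def vector (s : Store) (n r : ℕ) : Fin n → ℝ := fun i => s.real r i

end Store

/-- `Exec O P s t s'`: started in the memory `s` with access to the oracles `O`, the
program `P` halts after `t` steps in the memory `s'`. An oracle call is charged the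
length `n` of its query in addition to one step. -/
inductive Exec {n : ℕ} (O : Oracles n) : Prog → Store → ℕ → Store → Prop where
  | skip (s : Store) : Exec O .skip s 1 s
  | setNat (s : Store) (v : ℕ) (e : NExpr) :
      Exec O (.setNat v e) s (e.cost + 1) (s.setNat v (e.eval s))
  | setReal (s : Store) (r : ℕ) (i : NExpr) (e : RExpr) :
      Exec O (.setReal r i e) s (i.cost + e.cost + 1) (s.setReal r (i.eval s) (e.eval s))
  | setBit (s : Store) (x : ℕ) (i : NExpr) :
      Exec O (.setBit x i) s (i.cost + 1) (s.setBits x (insert (i.eval s) (s.bits x)))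
  | clearBit (s : Store) (x : ℕ) (i : NExpr) :
      Exec O (.clearBit x i) s (i.cost + 1) (s.setBits x ((s.bits x).erase (i.eval s)))
  | queryValue (s : Store) (x r : ℕ) (i : NExpr) :
      Exec O (.queryValue x r i) s (i.cost + n + 1)
        (s.setReal r (i.eval s) (O.value (s.agents n x)))
  | queryDemand (s : Store) (r x : ℕ) :
      Exec O (.queryDemand r x) s (n + 1)
        (s.setBits x ((O.demand (s.vector n r)).map Fin.valEmbedding))
  | seq {P Q : Prog} {s₁ s₂ s₃ : Store} {t₁ t₂ : ℕ}
      (h₁ : Exec O P s₁ t₁ s₂) (h₂ : Exec O Q s₂ t₂ s₃) :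
      Exec O (.seq P Q) s₁ (t₁ + t₂) s₃
  | iteTrue {b : BExpr} {P Q : Prog} {s s' : Store} {t : ℕ}
      (hb : b.Holds s) (h : Exec O P s t s') : Exec O (.ite b P Q) s (b.cost + t) s'
  | iteFalse {b : BExpr} {P Q : Prog} {s s' : Store} {t : ℕ}
      (hb : ¬ b.Holds s) (h : Exec O Q s t s') : Exec O (.ite b P Q) s (b.cost + t) s'
  | whileTrue {b : BExpr} {P : Prog} {s₁ s₂ s₃ : Store} {t₁ t₂ : ℕ}
      (hb : b.Holds s₁) (h₁ : Exec O P s₁ t₁ s₂) (h₂ : Exec O (.while b P) s₂ t₂ s₃) :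
      Exec O (.while b P) s₁ (b.cost + t₁ + t₂) s₃
  | whileFalse {b : BExpr} {P : Prog} {s : Store}
      (hb : ¬ b.Holds s) : Exec O (.while b P) s b.cost s

/-- The initial memory: counter `0` holds `n`, cells `0, …, n - 1` of the real array `0`
hold the costs, cell `0` of the real array `1` holds `a`, all else is zero or empty. -/
def initStore {n : ℕ} (a : ℝ) (c : Fin n → ℝ) : Store where
  nat v := if v = 0 then n else 0
  real r k := if r = 0 then (if h : k < n then c ⟨k, h⟩ else 0)
    else if r = 1 ∧ k = 0 then a else 0
  bits _ := ∅

/-- On input `(n, a, c)` and with oracles `O`, the program `P` halts within `t` steps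
with the set `U` of agents in its bit array `0`. -/
def Outputs {n : ℕ} (P : Prog) (O : Oracles n) (a : ℝ) (c : Fin n → ℝ) (t : ℕ)
    (U : Finset (Fin n)) : Prop :=
  ∃ (t' : ℕ) (s : Store), Exec O P (initStore a c) t' s ∧ t' ≤ t ∧ s.agents n 0 = U

end RealRAM

end

/-! ## XOS functions -/

section XOS

variable {n : ℕ} {f : Finset (Fin n) → ℝ}

/-! The marginals m_i of an optimal team S are unknown, but Cauchy–Schwarz eliminates them: for T ⊆
S with S feasible, ∑ √c_i ≤ √(∑ c_i/m_i) · √(∑ m_i) ≤ √f(T), sums over T, because marginals of an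
XOS function add up to at most the value (`sum_marginal_le`). Hence for a guess x ≤ f(T) the prices
p_i = (a/2)√x√c_i charge T at most (a/2)f(T), and an `a`-demand set at these prices has value minus
price at least (a/2)x. Conversely, in a team whose marginals are at least p_i/2, agent i needs a
share of at most 8p_i/(a²x), so the total share is at most 1/2 once the total price is at most
a²x/16. Pruning the demand set at p, truncating it to value a²x/16 and pruning again at p/2 produces
such a team while keeping a constant fraction of a²x (`IsCandidate.le_realUtility`).

It remains to find x. At most one agent of a feasible team needs a share above 1/2; a singleton team
makes up for that agent (`Feasible.exists_welfare_le`). The others, R, are cheap: 2c_i ≤ f({i}). So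
the largest value M of a single cheap agent is at most twice the best singleton utility. Either
a²f(R) is at most a constant times M, and a singleton suffices, or one of the guesses M, 2M, …, nM
lies below f(R) by less than M (`optWelfare_le`).

All properties of XOS functions in use come from an additive minorant that is tight at a given set
(`exists_support`). The rest is program verification: `Halts` couples total correctness with a step
bound, and loop invariants carry the execution of `algorithm` to the hypotheses of `optWelfare_le`.
-/

theorem IsXOS.exists_support (hf : IsXOS f) (S : Finset (Fin n)) :
    ∃ w : Fin n → ℝ, (∀ i, 0 ≤ w i) ∧ additiveCost w S = f S ∧ ∀ T, additiveCost w T ≤ f T := by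
  obtain ⟨k, w, hw, h⟩ := hf
  obtain ⟨l, hl⟩ := (h S).1
  exact ⟨w l, hw l, hl, fun T => (h T).2 ⟨l, rfl⟩⟩

theorem IsXOS.le_sum_singleton (hf : IsXOS f) (S : Finset (Fin n)) : f S ≤ ∑ i ∈ S, f {i} := by
  obtain ⟨w, -, hS, hT⟩ := hf.exists_support S
  rw [← hS]
  refine Finset.sum_le_sum fun i _ => ?_
  simpa [additiveCost] using hT {i}

theorem IsXOS.le_add_of_disjoint (hf : IsXOS f) {S T : Finset (Fin n)} (hd : Disjoint S T) :
    f (S ∪ T) ≤ f S + f T := by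
  obtain ⟨w, -, hS, hT⟩ := hf.exists_support (S ∪ T)
  rw [← hS, additiveCost, Finset.sum_union hd]
  exact add_le_add (hT S) (hT T)

theorem IsXOS.le_erase_add_singleton (hf : IsXOS f) {S : Finset (Fin n)} {i : Fin n} (hi : i ∈ S) :
    f S ≤ f (S.erase i) + f {i} := by
  have h := hf.le_add_of_disjoint (S := S.erase i) (T := {i}) (by simp)
  have e : S.erase i ∪ {i} = S := by
    rw [Finset.union_comm, ← Finset.insert_eq, Finset.insert_erase hi]
  rwa [e] at h

end XOS

/-! ### Marginals in contract settings -/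

namespace ContractSetting

variable {n : ℕ} (I : ContractSetting n)

theorem f_nonneg (S : Finset (Fin n)) : 0 ≤ I.f S := I.f_empty ▸ I.f_mono ∅ S (Finset.empty_subset S)

theorem marginal_of_mem {i : Fin n} {S : Finset (Fin n)} (hi : i ∈ S) :
    I.marginal i S = I.f S - I.f (S.erase i) := by
  rw [marginal, Finset.insert_eq_of_mem hi]

theorem marginal_le_value {i : Fin n} {S : Finset (Fin n)} (hi : i ∈ S) :
    I.marginal i S ≤ I.f S := by
  rw [I.marginal_of_mem hi]
  linarith [I.f_nonneg (S.erase i)]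

theorem marginal_singleton (i : Fin n) : I.marginal i {i} = I.f {i} := by
  simp [marginal, I.f_empty]

variable {I}

theorem marginal_le_singleton (hf : IsXOS I.f) {i : Fin n} {S : Finset (Fin n)} (hi : i ∈ S) :
    I.marginal i S ≤ I.f {i} := by
  rw [I.marginal_of_mem hi]
  linarith [hf.le_erase_add_singleton hi]

/-- Let `w` support `f` at `S`. Since `w` stays below `f` at `S.erase i`, the marginal of `i` is at
most `w i`; these weights sum over `T` to at most `f T`. -/
theorem sum_marginal_le (hf : IsXOS I.f) {S T : Finset (Fin n)} (hTS : T ⊆ S) :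
    ∑ i ∈ T, I.marginal i S ≤ I.f T := by
  obtain ⟨w, -, hS, hT⟩ := hf.exists_support S
  refine le_trans (Finset.sum_le_sum fun i hi => ?_) (hT T)
  rw [I.marginal_of_mem (hTS hi)]
  have h := hT (S.erase i)
  have e : additiveCost w S = w i + additiveCost w (S.erase i) :=
    (Finset.add_sum_erase S w (hTS hi)).symm
  linarith

variable (I)

/-! ### Shares as real numbers -/

/-- The minimum share of agent `i` in the team `S`, with `2` in place of `∞`. -/
noncomputable def realShare (i : Fin n) (S : Finset (Fin n)) : ℝ :=
  if I.marginal i S ≤ 0 then 2 else I.c i / I.marginal i S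

/-- The minimum total share of the team `S`, with `2` in place of each infinite share. -/
noncomputable def realTotalShare (S : Finset (Fin n)) : ℝ := ∑ i ∈ S, I.realShare i S

/-- The principal's utility of a feasible team, as a real number. -/
noncomputable def realUtility (S : Finset (Fin n)) : ℝ := (1 - I.realTotalShare S) * I.f S

theorem realShare_nonneg (i : Fin n) (S : Finset (Fin n)) : 0 ≤ I.realShare i S := by
  unfold realShare
  split_ifs with h
  · norm_num
  · exact div_nonneg (I.c_pos i).le (not_le.1 h).le

theorem realTotalShare_nonneg (S : Finset (Fin n)) : 0 ≤ I.realTotalShare S :=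
  Finset.sum_nonneg fun i _ => I.realShare_nonneg i S

theorem share_eq_top {i : Fin n} {S : Finset (Fin n)} (h : I.marginal i S ≤ 0) :
    I.share i S = ∞ := by
  rw [share, ENNReal.ofReal_of_nonpos h, ENNReal.div_zero]
  simpa using I.c_pos i

theorem share_eq_ofReal {i : Fin n} {S : Finset (Fin n)} (h : 0 < I.marginal i S) :
    I.share i S = ENNReal.ofReal (I.c i / I.marginal i S) := by
  rw [share, ENNReal.ofReal_div_of_pos h]

variable {I}

theorem Feasible.marginal_pos {S : Finset (Fin n)} (h : I.Feasible S) {i : Fin n} (hi : i ∈ S) :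
    0 < I.marginal i S := by
  by_contra! hm
  have h1 : I.share i S ≤ I.totalShare S :=
    Finset.single_le_sum (f := fun i => I.share i S) (fun _ _ => zero_le) hi
  rw [I.share_eq_top hm] at h1
  exact absurd (h1.trans h) (by simp)

theorem marginal_pos_of_realTotalShare_le {S : Finset (Fin n)} (h : I.realTotalShare S ≤ 1)
    {i : Fin n} (hi : i ∈ S) : 0 < I.marginal i S := by
  by_contra! hm
  have h1 : I.realShare i S ≤ I.realTotalShare S :=
    Finset.single_le_sum (f := fun i => I.realShare i S) (fun j _ => I.realShare_nonneg j S) hi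
  rw [realShare, if_pos hm] at h1
  linarith

theorem totalShare_eq_ofReal {S : Finset (Fin n)} (h : ∀ i ∈ S, 0 < I.marginal i S) :
    I.totalShare S = ENNReal.ofReal (I.realTotalShare S) := by
  rw [totalShare, realTotalShare, ENNReal.ofReal_sum_of_nonneg fun i _ => I.realShare_nonneg i S]
  refine Finset.sum_congr rfl fun i hi => ?_
  rw [I.share_eq_ofReal (h i hi), realShare, if_neg (not_le.2 (h i hi))]

/-- Any finite stand-in for `∞` above `1` would do: one agent without a positive marginal already
breaks the budget. This lets a program with real registers decide feasibility. -/
theorem feasible_iff {S : Finset (Fin n)} : I.Feasible S ↔ I.realTotalShare S ≤ 1 := by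
  constructor
  · intro h
    have h' := h
    rw [Feasible, totalShare_eq_ofReal fun i hi => h.marginal_pos hi] at h'
    simpa using h'
  · intro h
    rw [Feasible, totalShare_eq_ofReal fun i hi => marginal_pos_of_realTotalShare_le h hi]
    simpa using h

theorem Feasible.utility_eq {S : Finset (Fin n)} (h : I.Feasible S) :
    I.utility S = (I.realUtility S : EReal) := by
  rw [utility, totalShare_eq_ofReal fun i hi => h.marginal_pos hi, realUtility, EReal.coe_mul,
    EReal.coe_sub, EReal.coe_one, EReal.coe_ennreal_ofReal,
    max_eq_left (I.realTotalShare_nonneg S)]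

theorem realTotalShare_singleton (i : Fin n) : I.realTotalShare {i} = I.c i / I.f {i} := by
  have h : 0 < I.f {i} := (I.c_pos i).trans_le (I.c_le i)
  rw [realTotalShare, Finset.sum_singleton, realShare, I.marginal_singleton, if_neg (not_le.2 h)]

theorem feasible_singleton (i : Fin n) : I.Feasible {i} := by
  have h : 0 < I.f {i} := (I.c_pos i).trans_le (I.c_le i)
  rw [feasible_iff, realTotalShare_singleton, div_le_one h]
  exact I.c_le i

theorem realUtility_singleton (i : Fin n) : I.realUtility {i} = I.f {i} - I.c i := by
  have h : 0 < I.f {i} := (I.c_pos i).trans_le (I.c_le i)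
  rw [realUtility, realTotalShare_singleton]
  field_simp

theorem realUtility_empty : I.realUtility ∅ = 0 := by simp [realUtility, I.f_empty]

/-! ### The agents of a feasible team with a small share -/

theorem Feasible.sum_div_marginal_le {S : Finset (Fin n)} (h : I.Feasible S)
    {T : Finset (Fin n)} (hTS : T ⊆ S) : ∑ i ∈ T, I.c i / I.marginal i S ≤ 1 := by
  refine le_trans ?_ (feasible_iff.1 h)
  calc ∑ i ∈ T, I.c i / I.marginal i S = ∑ i ∈ T, I.realShare i S :=
        Finset.sum_congr rfl fun i hi => by
          rw [realShare, if_neg (not_le.2 (h.marginal_pos (hTS hi)))]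
    _ ≤ I.realTotalShare S :=
        Finset.sum_le_sum_of_subset_of_nonneg hTS fun i _ _ => I.realShare_nonneg i S

/-- Cauchy–Schwarz applied to √c_i = √(c_i/m_i) · √m_i. The resulting bound is free of the
marginals, which is why prices proportional to √c_i work. -/
theorem Feasible.sum_sqrt_cost_le (hf : IsXOS I.f) {S : Finset (Fin n)} (h : I.Feasible S)
    {T : Finset (Fin n)} (hTS : T ⊆ S) : ∑ i ∈ T, √(I.c i) ≤ √(I.f T) := by
  apply Real.le_sqrt_of_sq_le
  have hpos : ∀ i ∈ T, 0 < I.marginal i S := fun i hi => h.marginal_pos (hTS hi)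
  calc (∑ i ∈ T, √(I.c i)) ^ 2
      ≤ (∑ i ∈ T, I.c i / I.marginal i S) * ∑ i ∈ T, I.marginal i S := by
        refine Finset.sum_sq_le_sum_mul_sum_of_sq_le_mul T
          (fun i hi => div_nonneg (I.c_pos i).le (hpos i hi).le) (fun i hi => (hpos i hi).le) ?_
        intro i hi
        rw [Real.sq_sqrt (I.c_pos i).le, div_mul_cancel₀ _ (hpos i hi).ne']
    _ ≤ 1 * I.f T := mul_le_mul (h.sum_div_marginal_le hTS) (sum_marginal_le hf hTS)
        (Finset.sum_nonneg fun i hi => (hpos i hi).le) zero_le_one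
    _ = I.f T := one_mul _

/-- Up to one agent, a feasible team consists of agents whose costs are at most half their
marginals. -/
theorem Feasible.exists_welfare_le (hf : IsXOS I.f) {S : Finset (Fin n)} (h : I.Feasible S)
    {G : ℝ} (hG : 0 ≤ G) (hsing : ∀ i, I.f {i} - I.c i ≤ G) :
    ∃ R ⊆ S, (∀ i ∈ R, 2 * I.c i ≤ I.f {i}) ∧ I.welfare S ≤ G + I.f R := by
  classical
  set R := S.filter fun i => 2 * I.c i ≤ I.marginal i S with hR
  have hRS : R ⊆ S := Finset.filter_subset _ _
  refine ⟨R, hRS, fun i hi => ?_, ?_⟩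
  · rw [hR, Finset.mem_filter] at hi
    exact hi.2.trans (marginal_le_singleton hf hi.1)
  -- Two agents with shares above 1/2 would exceed the budget.
  have hcard : ∀ i ∈ S \ R, ∀ j ∈ S \ R, i = j := by
    intro i hi j hj
    by_contra hij
    have half : ∀ k ∈ S \ R, k ∈ S ∧ 1 / 2 < I.c k / I.marginal k S := by
      intro k hk
      rw [hR, Finset.mem_sdiff, Finset.mem_filter, not_and, not_le] at hk
      refine ⟨hk.1, ?_⟩
      rw [lt_div_iff₀ (h.marginal_pos hk.1)]
      linarith [hk.2 hk.1]
    have hsum := h.sum_div_marginal_le (T := {i, j})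
      (by simp [Finset.insert_subset_iff, (half i hi).1, (half j hj).1])
    rw [Finset.sum_pair hij] at hsum
    linarith [(half i hi).2, (half j hj).2]
  have hcR : 0 ≤ additiveCost I.c R := Finset.sum_nonneg fun i _ => (I.c_pos i).le
  -- By subadditivity the agent left out, if any, adds at most `f {i} - c i ≤ G` to the welfare; the
  -- costs of `R` are dropped.
  rcases (S \ R).eq_empty_or_nonempty with he | ⟨i, hi⟩
  · have : S = R := (Finset.sdiff_eq_empty_iff_subset.1 he).antisymm hRS
    rw [welfare, this]
    linarith
  · have hSR : S \ R = {i} := by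
      ext j
      simp only [Finset.mem_singleton]
      exact ⟨fun hj => hcard j hj i hi, fun hj => hj ▸ hi⟩
    have hS : S = R ∪ {i} := by rw [← hSR, Finset.union_sdiff_of_subset hRS]
    have hd : Disjoint R {i} := hSR ▸ Finset.disjoint_sdiff
    have h1 := hf.le_add_of_disjoint hd
    have h2 : additiveCost I.c S = additiveCost I.c R + I.c i := by
      rw [hS, additiveCost, Finset.sum_union hd, Finset.sum_singleton, additiveCost]
    rw [← hS] at h1
    rw [welfare, h2]
    linarith [hsing i]

/-! ### Pruning and truncating teams -/

variable (I)

/-- `Y` arises from the team `X` by removing agents, at no loss in value minus prices `p`,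
so that the marginals of the remaining agents cover their prices. -/
structure IsPruned (p : Fin n → ℝ) (X Y : Finset (Fin n)) : Prop where
  subset : Y ⊆ X
  price_le : ∀ i ∈ Y, p i ≤ I.marginal i Y
  value_le : I.f X - additiveCost p X ≤ I.f Y - additiveCost p Y

/-- `Y` arises from the team `X` by removing agents until the value is at most `t`. -/
structure IsTruncated (t : ℝ) (X Y : Finset (Fin n)) : Prop where
  subset : Y ⊆ X
  value_le : I.f Y ≤ t ∨ Y = ∅
  eq_or : Y = X ∨ ∃ i ∈ X, t - I.f {i} ≤ I.f Y

/-- `U` is a possible result of processing the answer `D` of a demand query at the prices `p`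
with the truncation level `t`. -/
def IsCandidate (p : Fin n → ℝ) (t : ℝ) (D U : Finset (Fin n)) : Prop :=
  ∃ Y Z, I.IsPruned p D Y ∧ I.IsTruncated t Y Z ∧ I.IsPruned (fun i => 1 / 2 * p i) Z U

/-- The prices for the guess `x` of the value of the best team of cheap agents;
`A` is the set of cheap agents. -/
noncomputable def prices (a x : ℝ) (A : Finset (Fin n)) (i : Fin n) : ℝ :=
  if i ∈ A then a / 2 * √x * √(I.c i) else I.f Finset.univ + 1

variable {I}

theorem prices_nonneg {a x : ℝ} (ha : 0 ≤ a) (A : Finset (Fin n)) (i : Fin n) :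
    0 ≤ I.prices a x A i := by
  unfold prices
  split_ifs
  · positivity
  · linarith [I.f_nonneg Finset.univ]

theorem additiveCost_const_mul (q : ℝ) (p : Fin n → ℝ) (S : Finset (Fin n)) :
    additiveCost (fun i => q * p i) S = q * additiveCost p S :=
  (Finset.mul_sum S p q).symm

/-- If the guess `x` is close to the value of a team `R` of cheap agents, a processed demand
set is a feasible team whose utility is at least a constant fraction of `x`. -/
theorem IsCandidate.le_realUtility (hf : IsXOS I.f) {a : ℝ} (ha : 0 < a) (ha1 : a ≤ 1)
    {D : (Fin n → ℝ) → Finset (Fin n)} (hD : IsDemandOracle a I.f D)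
    {A R U : Finset (Fin n)} {M x : ℝ} (hM : ∀ i ∈ A, I.f {i} ≤ M) (hRA : R ⊆ A)
    (hR : ∑ i ∈ R, √(I.c i) ≤ √(I.f R)) (hx : 0 < x) (hxR : x ≤ I.f R)
    (hMx : 80 * M ≤ a ^ 2 * x)
    (hU : I.IsCandidate (I.prices a x A) (a * a * x / 16) (D (I.prices a x A)) U) :
    I.Feasible U ∧ a ^ 2 * x ≤ 80 * I.realUtility U := by
  obtain ⟨Y, Z, hY, hZ, hUZ⟩ := hU
  set p := I.prices a x A with hp
  have ha2 : a ^ 2 ≤ a := by nlinarith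
  -- Outside `A` the price exceeds the value of the set of all agents, so no marginal can cover it.
  have hYA : Y ⊆ A := by
    intro i hi
    by_contra hiA
    have h1 := hY.price_le i hi
    have h2 := I.marginal_le_value hi
    have h3 := I.f_mono Y Finset.univ (Finset.subset_univ _)
    have h4 : p i = I.f Finset.univ + 1 := by rw [hp, prices, if_neg hiA]
    linarith
  -- After pruning at `p`, every subteam costs at most its value, although its own marginals may be
  -- smaller than those in `Y`.
  have hpY : ∀ T ⊆ Y, additiveCost p T ≤ I.f T := fun T hT =>
    (Finset.sum_le_sum fun i hi => hY.price_le i (hT hi)).trans (sum_marginal_le hf hT)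
  have hpA : ∀ i ∈ A, p i = a / 2 * √x * √(I.c i) := fun i hi => by rw [hp, prices, if_pos hi]
  have hpR : additiveCost p R ≤ a / 2 * I.f R := by
    have e : additiveCost p R = a / 2 * √x * ∑ i ∈ R, √(I.c i) := by
      rw [additiveCost, Finset.mul_sum]
      exact Finset.sum_congr rfl fun i hi => hpA i (hRA hi)
    have hfR : 0 ≤ I.f R := I.f_nonneg R
    calc additiveCost p R ≤ a / 2 * √(I.f R) * √(I.f R) := by
          rw [e]
          gcongr
      _ = a / 2 * I.f R := by rw [mul_assoc, Real.mul_self_sqrt hfR]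
  -- The demand guarantee against `R` leaves a·f(R) − (a/2)·f(R), and pruning does not lose any of
  -- it.
  have hfY : a / 2 * x ≤ I.f Y := by
    have h1 := hD p (fun i => prices_nonneg ha.le A i) R
    have h2 := hY.value_le
    have h3 : 0 ≤ additiveCost p Y := Finset.sum_nonneg fun i _ => prices_nonneg ha.le A i
    nlinarith
  -- The last removal loses at most `M`, and 1/16 − 1/80 = 1/20.
  have hfZ : a ^ 2 * x / 20 ≤ I.f Z := by
    rcases hZ.eq_or with rfl | ⟨i, hi, hiZ⟩
    · nlinarith
    · have := hM i (hYA hi)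
      nlinarith
  have hZY := hZ.subset
  have hUZ' := hUZ.subset
  -- The second pruning uses half prices so that, with p(Z) ≤ f(Z), at least half of f(Z) survives.
  have hfU : a ^ 2 * x / 40 ≤ I.f U := by
    have h1 := hUZ.value_le
    rw [additiveCost_const_mul, additiveCost_const_mul] at h1
    have h2 := hpY Z hZY
    have h3 : 0 ≤ additiveCost p U := Finset.sum_nonneg fun i _ => prices_nonneg ha.le A i
    linarith
  have hfU' : I.f U ≤ a ^ 2 * x / 16 := by
    rcases hZ.value_le with h | h
    · have := I.f_mono U Z hUZ'
      linarith
    · have : U = ∅ := Finset.subset_empty.1 (h ▸ hUZ')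
      rw [this, I.f_empty]
      positivity
  -- The square of a price is a²x/4 times the cost, so cost over half the price is again a multiple
  -- of the price.
  have hshare : ∀ i ∈ U, I.realShare i U ≤ 8 / (a ^ 2 * x) * p i := by
    intro i hi
    have hiA := hYA (hZY (hUZ' hi))
    have hc := I.c_pos i
    have hpos : 0 < p i := by
      rw [hpA i hiA]
      positivity
    have h1 := hUZ.price_le i hi
    have hm : 0 < I.marginal i U := by linarith
    rw [realShare, if_neg (not_le.2 hm)]
    calc I.c i / I.marginal i U ≤ I.c i / (1 / 2 * p i) := by gcongr
      _ = 8 / (a ^ 2 * x) * p i := by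
        have hsq : p i * p i = a ^ 2 * x / 4 * I.c i := by
          rw [hpA i hiA]
          calc a / 2 * √x * √(I.c i) * (a / 2 * √x * √(I.c i))
              = a ^ 2 / 4 * (√x * √x) * (√(I.c i) * √(I.c i)) := by ring
            _ = a ^ 2 * x / 4 * I.c i := by
              rw [Real.mul_self_sqrt hx.le, Real.mul_self_sqrt hc.le]
              ring
        field_simp
        nlinarith
  -- The truncation level a²x/16 is chosen to make this total 1/2.
  have hrho : I.realTotalShare U ≤ 1 / 2 := by
    calc I.realTotalShare U ≤ 8 / (a ^ 2 * x) * additiveCost p U := by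
          rw [additiveCost, Finset.mul_sum]
          exact Finset.sum_le_sum hshare
      _ ≤ 8 / (a ^ 2 * x) * (a ^ 2 * x / 16) := by
          gcongr
          exact (hpY U (hUZ'.trans hZY)).trans hfU'
      _ = 1 / 2 := by
          field_simp
          norm_num
  refine ⟨feasible_iff.2 (by linarith), ?_⟩
  have h0 := I.f_nonneg U
  have : 1 / 2 * I.f U ≤ I.realUtility U := by
    unfold realUtility
    gcongr
    linarith
  linarith

/-- The approximation guarantee of a value `G` that is at least the utility of every single
agent and of every feasible processed demand set. -/
theorem optWelfare_le (hf : IsXOS I.f) {a : ℝ} (ha : 0 < a) (ha1 : a ≤ 1)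
    {D : (Fin n → ℝ) → Finset (Fin n)} (hD : IsDemandOracle a I.f D)
    {A : Finset (Fin n)} {M G : ℝ} (hA : ∀ i, i ∈ A ↔ I.c i + I.c i ≤ I.f {i})
    (hM0 : 0 ≤ M) (hM : ∀ i ∈ A, I.f {i} ≤ M) (hMG : M ≤ 2 * G)
    (hsing : ∀ i, I.realUtility {i} ≤ G)
    (hcand : ∀ k : ℕ, 1 ≤ k → k ≤ n → ∃ U,
      I.IsCandidate (I.prices a (k * M) A) (a * a * (k * M) / 16) (D (I.prices a (k * M) A)) U ∧
        (I.Feasible U → I.realUtility U ≤ G)) :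
    I.optWelfare ≤ 188 / a ^ 2 * G := by
  classical
  have hG : 0 ≤ G := by linarith
  have ha2 : 0 < a ^ 2 := by positivity
  have ha21 : a ^ 2 ≤ 1 := by nlinarith
  refine Finset.sup'_le _ _ fun S hS => ?_
  have hS : I.Feasible S := (Finset.mem_filter.1 hS).2
  obtain ⟨R, hRS, hR, hw⟩ := hS.exists_welfare_le hf hG
    (fun i => realUtility_singleton (I := I) i ▸ hsing i)
  -- Together with the extra `G` this gives the factor 163/a², so 188 leaves room.
  suffices h : a ^ 2 * I.f R ≤ 162 * G by
    rw [div_mul_eq_mul_div, le_div_iff₀ ha2]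
    nlinarith
  have hRA : R ⊆ A := fun i hi => (hA i).2 (by linarith [hR i hi])
  -- 81 = 80 + 1: rounding the guess down costs less than `M`, and 80 is what the candidate bound
  -- needs. In the other case `M ≤ 2 * G` yields 162.
  by_cases hcase : a ^ 2 * I.f R ≤ 81 * M
  · linarith
  rw [not_le] at hcase
  have hfRM : I.f R ≤ n * M := by
    calc I.f R ≤ ∑ i ∈ R, I.f {i} := hf.le_sum_singleton R
      _ ≤ ∑ _i ∈ R, M := Finset.sum_le_sum fun i hi => hM i (hRA hi)
      _ = (R.card : ℝ) * M := by rw [Finset.sum_const, nsmul_eq_mul]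
      _ ≤ n * M := by
        gcongr
        simpa using Finset.card_le_univ R
  have hMpos : 0 < M := by
    refine hM0.lt_of_ne fun h => ?_
    rw [← h] at hfRM hcase
    nlinarith
  have hfR : I.f R / M ≥ 0 := div_nonneg (I.f_nonneg R) hM0
  -- The best guess is the largest multiple of `M` not above `f R`; subadditivity keeps the
  -- multiplier at most `n`.
  set k := ⌊I.f R / M⌋₊ with hk
  have hk1 : (k : ℝ) * M ≤ I.f R := (le_div_iff₀ hMpos).1 (Nat.floor_le hfR)
  have hk2 : I.f R < (k + 1) * M := (div_lt_iff₀ hMpos).1 (Nat.lt_floor_add_one _)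
  have hkn : k ≤ n := by
    have : (k : ℝ) ≤ n := le_of_mul_le_mul_right (hk1.trans hfRM) hMpos
    exact_mod_cast this
  have hMk : 80 * M ≤ a ^ 2 * (k * M) := by nlinarith
  have hkM : 0 < (k : ℝ) * M := by nlinarith
  have hk0 : 1 ≤ k := Nat.one_le_iff_ne_zero.2 fun h => by simp [h] at hkM
  obtain ⟨U, hU, hUG⟩ := hcand k hk0 hkn
  obtain ⟨hfeas, hval⟩ := hU.le_realUtility hf ha ha1 hD hM hRA (hS.sum_sqrt_cost_le hf hRS)
    hkM hk1 hMk
  have := hUG hfeas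
  nlinarith

end ContractSetting

/-! ## Total correctness of real random access programs -/

namespace RealRAM

namespace Store

variable (s : Store)

@[simp] theorem nat_setNat (v k w : ℕ) :
    (s.setNat v k).nat w = if w = v then k else s.nat w := by
  simp [setNat, Function.update_apply]

@[simp] theorem real_setNat (v k : ℕ) : (s.setNat v k).real = s.real := rfl

@[simp] theorem bits_setNat (v k : ℕ) : (s.setNat v k).bits = s.bits := rfl

@[simp] theorem nat_setReal (r i : ℕ) (x : ℝ) : (s.setReal r i x).nat = s.nat := rfl

@[simp] theorem real_setReal (r i : ℕ) (x : ℝ) (r' k : ℕ) :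
    (s.setReal r i x).real r' k = if r' = r ∧ k = i then x else s.real r' k := by
  by_cases h : r' = r
  · subst h
    simp [setReal, Function.update_apply]
  · simp [setReal, h]

@[simp] theorem bits_setReal (r i : ℕ) (x : ℝ) : (s.setReal r i x).bits = s.bits := rfl

@[simp] theorem nat_setBits (x : ℕ) (X : Finset ℕ) : (s.setBits x X).nat = s.nat := rfl

@[simp] theorem real_setBits (x : ℕ) (X : Finset ℕ) : (s.setBits x X).real = s.real := rfl

@[simp] theorem bits_setBits (x : ℕ) (X : Finset ℕ) (y : ℕ) :
    (s.setBits x X).bits y = if y = x then X else s.bits y := by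
  simp [setBits, Function.update_apply]

variable {s} {n : ℕ}

@[simp] theorem mem_agents {x : ℕ} {i : Fin n} : i ∈ s.agents n x ↔ (i : ℕ) ∈ s.bits x := by
  simp [agents]

@[simp] theorem agents_setNat (v k x : ℕ) : (s.setNat v k).agents n x = s.agents n x := rfl

@[simp] theorem agents_setReal (r i : ℕ) (y : ℝ) (x : ℕ) :
    (s.setReal r i y).agents n x = s.agents n x := rfl

theorem agents_congr {s' : Store} {x y : ℕ} (h : s'.bits y = s.bits x) :
    s'.agents n y = s.agents n x := by
  simp [agents, h]

theorem agents_setBits_of_ne {x y : ℕ} (h : y ≠ x) (X : Finset ℕ) :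
    (s.setBits x X).agents n y = s.agents n y :=
  agents_congr (by simp [h])

@[simp] theorem agents_setBits_erase (x : ℕ) (i : Fin n) :
    (s.setBits x ((s.bits x).erase (i : ℕ))).agents n x = (s.agents n x).erase i := by
  ext j
  simp [Fin.ext_iff]

@[simp] theorem agents_setBits_map (x : ℕ) (X : Finset (Fin n)) :
    (s.setBits x (X.map Fin.valEmbedding)).agents n x = X := by
  ext j
  simp [← Fin.ext_iff]

end Store

/-! ### Write sets, effects and step bounds of programs -/

namespace Prog

/-- The counters that a program may overwrite. -/
def WritesNat : Prog → ℕ → Prop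
  | setNat v _, w => w = v
  | seq P Q, w => P.WritesNat w ∨ Q.WritesNat w
  | ite _ P Q, w => P.WritesNat w ∨ Q.WritesNat w
  | .while _ P, w => P.WritesNat w
  | _, _ => False

/-- The real arrays that a program may overwrite. -/
def WritesReal : Prog → ℕ → Prop
  | setReal r _ _, w => w = r
  | queryValue _ r _, w => w = r
  | seq P Q, w => P.WritesReal w ∨ Q.WritesReal w
  | ite _ P Q, w => P.WritesReal w ∨ Q.WritesReal w
  | .while _ P, w => P.WritesReal w
  | _, _ => False

/-- The bit arrays that a program may overwrite. -/
def WritesBits : Prog → ℕ → Prop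
  | setBit x _, w => w = x
  | clearBit x _, w => w = x
  | queryDemand _ x, w => w = x
  | seq P Q, w => P.WritesBits w ∨ Q.WritesBits w
  | ite _ P Q, w => P.WritesBits w ∨ Q.WritesBits w
  | .while _ P, w => P.WritesBits w
  | _, _ => False

/-- Programs without loops. -/
def LoopFree : Prog → Prop
  | seq P Q => P.LoopFree ∧ Q.LoopFree
  | ite _ P Q => P.LoopFree ∧ Q.LoopFree
  | .while _ _ => False
  | _ => True

open scoped Classical in
/-- The effect of a loop-free program. -/
noncomputable def run {n : ℕ} (O : Oracles n) : Prog → Store → Store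
  | skip, s => s
  | setNat v e, s => s.setNat v (e.eval s)
  | setReal r i e, s => s.setReal r (i.eval s) (e.eval s)
  | setBit x i, s => s.setBits x (insert (i.eval s) (s.bits x))
  | clearBit x i, s => s.setBits x ((s.bits x).erase (i.eval s))
  | queryValue x r i, s => s.setReal r (i.eval s) (O.value (s.agents n x))
  | queryDemand r x, s => s.setBits x ((O.demand (s.vector n r)).map Fin.valEmbedding)
  | seq P Q, s => Q.run O (P.run O s)
  | ite b P Q, s => if b.Holds s then P.run O s else Q.run O s
  | .while _ _, s => s

/-- A bound on the number of steps of a loop-free program. -/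
def bound (n : ℕ) : Prog → ℕ
  | skip => 1
  | setNat _ e => e.cost + 1
  | setReal _ i e => i.cost + e.cost + 1
  | setBit _ i => i.cost + 1
  | clearBit _ i => i.cost + 1
  | queryValue _ _ i => i.cost + n + 1
  | queryDemand _ _ => n + 1
  | seq P Q => P.bound n + Q.bound n
  | ite b P Q => b.cost + (P.bound n + Q.bound n)
  | .while _ _ => 0

end Prog

/-- The store `s'` agrees with `s` on all arrays that `P` does not overwrite. -/
structure Frame (P : Prog) (s s' : Store) : Prop where
  nat : ∀ v, ¬ P.WritesNat v → s'.nat v = s.nat v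
  real : ∀ r, ¬ P.WritesReal r → s'.real r = s.real r
  bits : ∀ x, ¬ P.WritesBits x → s'.bits x = s.bits x

theorem Frame.agents {P : Prog} {s s' : Store} (h : Frame P s s') (n : ℕ) {x : ℕ}
    (hx : ¬ P.WritesBits x) : s'.agents n x = s.agents n x :=
  Store.agents_congr (h.bits x hx)

/-! ### A program logic for total correctness with step bounds -/

section

variable {n : ℕ} {O : Oracles n}

/-- Write sets are syntactic, so `simp` decides them, and facts about untouched memory bypass the
specification of a subprogram. -/
theorem Exec.frame {P : Prog} {s s' : Store} {t : ℕ} (h : Exec O P s t s') : Frame P s s' := by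
  induction h with
  | skip s => exact ⟨fun _ _ => rfl, fun _ _ => rfl, fun _ _ => rfl⟩
  | setNat s v e => exact ⟨fun w hw => Function.update_of_ne hw _ _, fun _ _ => rfl, fun _ _ => rfl⟩
  | setReal s r i e =>
    exact ⟨fun _ _ => rfl, fun w hw => Function.update_of_ne hw _ _, fun _ _ => rfl⟩
  | setBit s x i =>
    exact ⟨fun _ _ => rfl, fun _ _ => rfl, fun w hw => Function.update_of_ne hw _ _⟩
  | clearBit s x i =>
    exact ⟨fun _ _ => rfl, fun _ _ => rfl, fun w hw => Function.update_of_ne hw _ _⟩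
  | queryValue s x r i =>
    exact ⟨fun _ _ => rfl, fun w hw => Function.update_of_ne hw _ _, fun _ _ => rfl⟩
  | queryDemand s r x =>
    exact ⟨fun _ _ => rfl, fun _ _ => rfl, fun w hw => Function.update_of_ne hw _ _⟩
  | seq _ _ ih₁ ih₂ =>
    exact ⟨fun v hv => (ih₂.nat v fun h => hv (.inr h)).trans (ih₁.nat v fun h => hv (.inl h)),
      fun v hv => (ih₂.real v fun h => hv (.inr h)).trans (ih₁.real v fun h => hv (.inl h)),
      fun v hv => (ih₂.bits v fun h => hv (.inr h)).trans (ih₁.bits v fun h => hv (.inl h))⟩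
  | iteTrue _ _ ih =>
    exact ⟨fun v hv => ih.nat v fun h => hv (.inl h), fun v hv => ih.real v fun h => hv (.inl h),
      fun v hv => ih.bits v fun h => hv (.inl h)⟩
  | iteFalse _ _ ih =>
    exact ⟨fun v hv => ih.nat v fun h => hv (.inr h), fun v hv => ih.real v fun h => hv (.inr h),
      fun v hv => ih.bits v fun h => hv (.inr h)⟩
  | whileTrue _ _ _ ih₁ ih₂ =>
    exact ⟨fun v hv => (ih₂.nat v hv).trans (ih₁.nat v hv),
      fun v hv => (ih₂.real v hv).trans (ih₁.real v hv),
      fun v hv => (ih₂.bits v hv).trans (ih₁.bits v hv)⟩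
  | whileFalse _ => exact ⟨fun _ _ => rfl, fun _ _ => rfl, fun _ _ => rfl⟩

/-- Started in `s`, the program `P` halts within `B` steps in a store that satisfies `Q`. -/
def Halts (O : Oracles n) (P : Prog) (s : Store) (B : ℕ) (Q : Store → Prop) : Prop :=
  ∃ t s', Exec O P s t s' ∧ t ≤ B ∧ Q s'

namespace Halts

variable {P P' : Prog} {s : Store} {B B' : ℕ} {Q Q' : Store → Prop}

/-- Weakening the postcondition also supplies the frame of the execution, so specifications need not
state what is left unchanged. -/
theorem imp (h : Halts O P s B Q) (hQ : ∀ s', Frame P s s' → Q s' → Q' s') :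
    Halts O P s B Q' := by
  obtain ⟨t, s', h1, h2, h3⟩ := h
  exact ⟨t, s', h1, h2, hQ s' h1.frame h3⟩

theorem bound_mono (h : Halts O P s B Q) (hB : B ≤ B') : Halts O P s B' Q := by
  obtain ⟨t, s', h1, h2, h3⟩ := h
  exact ⟨t, s', h1, h2.trans hB, h3⟩

theorem seq (h : Halts O P s B fun s' => Halts O P' s' B' Q) :
    Halts O (.seq P P') s (B + B') Q := by
  obtain ⟨t, s', h1, h2, t', s'', h1', h2', h3⟩ := h
  exact ⟨_, s'', .seq h1 h1', add_le_add h2 h2', h3⟩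

/-- The sum of the branch bounds replaces their maximum because polynomials with natural
coefficients are closed under sums. -/
theorem ite {b : BExpr} (hP : b.Holds s → Halts O P s B Q)
    (hP' : ¬ b.Holds s → Halts O P' s B' Q) :
    Halts O (.ite b P P') s (b.cost + (B + B')) Q := by
  by_cases hb : b.Holds s
  · obtain ⟨t, s', h1, h2, h3⟩ := hP hb
    exact ⟨_, s', .iteTrue hb h1, by omega, h3⟩
  · obtain ⟨t, s', h1, h2, h3⟩ := hP' hb
    exact ⟨_, s', .iteFalse hb h1, by omega, h3⟩

/-- Reduces loop-free code to symbolic evaluation of `run`. The values of `run` and `bound` at loops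
are junk, excluded by `LoopFree`. -/
theorem of_loopFree (hP : P.LoopFree) (h : Q (P.run O s)) : Halts O P s (P.bound n) Q := by
  suffices h' : ∀ P : Prog, P.LoopFree → ∀ s, Halts O P s (P.bound n) (· = P.run O s) from
    (h' P hP s).imp fun s' _ hs' => hs' ▸ h
  intro P hP
  induction P with
  | skip => exact fun s => ⟨_, _, .skip s, le_rfl, rfl⟩
  | setNat v e => exact fun s => ⟨_, _, .setNat s v e, le_rfl, rfl⟩
  | setReal r i e => exact fun s => ⟨_, _, .setReal s r i e, le_rfl, rfl⟩
  | setBit x i => exact fun s => ⟨_, _, .setBit s x i, le_rfl, rfl⟩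
  | clearBit x i => exact fun s => ⟨_, _, .clearBit s x i, le_rfl, rfl⟩
  | queryValue x r i => exact fun s => ⟨_, _, .queryValue s x r i, le_rfl, rfl⟩
  | queryDemand r x => exact fun s => ⟨_, _, .queryDemand s r x, le_rfl, rfl⟩
  | seq P Q ihP ihQ =>
    intro s
    exact seq ((ihP hP.1 s).imp fun s' _ hs' => hs' ▸ ihQ hP.2 _)
  | ite b P Q ihP ihQ =>
    intro s
    refine ite (fun hb => (ihP hP.1 s).imp fun s' _ hs' => ?_)
      fun hb => (ihQ hP.2 s).imp fun s' _ hs' => ?_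
    · rw [hs', Prog.run, if_pos hb]
    · rw [hs', Prog.run, if_neg hb]
  | _ b P => exact hP.elim

theorem while_of_measure {b : BExpr} {J : Store → Prop} (m : Store → ℕ) (hJ : J s)
    (step : ∀ s, J s → b.Holds s → Halts O P s B fun s' => J s' ∧ m s' < m s) :
    Halts O (.while b P) s (m s * (b.cost + B) + b.cost) fun s' => J s' ∧ ¬ b.Holds s' := by
  induction hk : m s using Nat.strong_induction_on generalizing s with
  | _ k ih =>
    by_cases hb : b.Holds s
    · obtain ⟨t, s', h1, h2, hJ', hm⟩ := step s hJ hb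
      obtain ⟨t', s'', h1', h2', h3⟩ := ih _ (hk ▸ hm) hJ' rfl
      refine ⟨_, s'', .whileTrue hb h1 h1', ?_, h3⟩
      -- The drop of the measure by at least one pays for one test and one iteration.
      have : (m s' + 1) * (b.cost + B) ≤ k * (b.cost + B) := Nat.mul_le_mul_right _ (by omega)
      rw [add_mul] at this
      omega
    · exact ⟨_, s, .whileFalse hb, Nat.le_add_left _ _, hJ, hb⟩

end Halts

/-- Repeat `P` with the counter `v` running through `0, …, n - 1`. -/
def forLoop (v : ℕ) (P : Prog) : Prog :=
  .seq (.setNat v (.const 0))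
    (.while (.natLe (.add (.var v) (.const 1)) (.var 0))
      (.seq P (.setNat v (.add (.var v) (.const 1)))))

/-- A bound on the number of steps of a counting loop whose body takes at most `B` steps. -/
def forBound (n B : ℕ) : ℕ := n * (B + 9) + 7

theorem Halts.forLoop {v : ℕ} {P : Prog} {s : Store} {B : ℕ} {J : ℕ → Store → Prop}
    (h0 : s.nat 0 = n) (hv : v ≠ 0) (hP0 : ¬ P.WritesNat 0) (hPv : ¬ P.WritesNat v)
    (hJ : J 0 (s.setNat v 0))
    (step : ∀ (i : Fin n) (s : Store), s.nat 0 = n → s.nat v = i → J i s →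
      Halts O P s B fun s' => J (i + 1) (s'.setNat v (i + 1))) :
    Halts O (forLoop v P) s (forBound n B) (J n) := by
  have hloop := Halts.while_of_measure (O := O)
    (P := .seq P (.setNat v (.add (.var v) (.const 1)))) (B := B + 4) (s := s.setNat v 0)
    (b := .natLe (.add (.var v) (.const 1)) (.var 0))
    (J := fun s => s.nat 0 = n ∧ s.nat v ≤ n ∧ J (s.nat v) s) (fun s => n - s.nat v)
    ⟨by simp [hv.symm, h0], by simp, by simpa using hJ⟩ ?_
  · refine (Halts.seq (B := 2) (B' := n * (B + 9) + 5)
      ⟨2, _, .setNat s v (.const 0), le_rfl, (hloop.bound_mono ?_).imp ?_⟩).bound_mono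
        (le_of_eq (by rw [forBound]; ring))
    · simp only [Store.nat_setNat, if_true, BExpr.cost, NExpr.cost]
      rw [Nat.sub_zero]
      exact le_of_eq (by ring)
    · rintro s' - ⟨⟨h1, h2, h3⟩, h4⟩
      have : s'.nat v = n := by
        simp only [BExpr.Holds, NExpr.eval, h1, not_le] at h4
        omega
      rwa [this] at h3
  · rintro s ⟨h1, h2, h3⟩ hb
    have hlt : s.nat v < n := by
      simp only [BExpr.Holds, NExpr.eval, h1] at hb
      omega
    refine Halts.seq ((step ⟨s.nat v, hlt⟩ s h1 rfl h3).imp fun s' hfr hJ' => ?_)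
    have e0 := hfr.nat 0 hP0
    have ev := hfr.nat v hPv
    refine ⟨4, _, .setNat s' v _, le_rfl, ?_⟩
    simp only [NExpr.eval, ev, Store.nat_setNat, hv.symm, if_true, if_false, e0, h1]
    exact ⟨⟨trivial, hlt, hJ'⟩, by omega⟩

end

/-! ### Polynomial bounds -/

/-- A function given by a polynomial with natural coefficients. -/
def IsPoly (b : ℕ → ℕ) : Prop := ∃ T : Polynomial ℕ, ∀ n, T.eval n = b n

namespace IsPoly

theorem const (k : ℕ) : IsPoly fun _ => k := ⟨.C k, fun n => by simp⟩

theorem id : IsPoly fun n => n := ⟨.X, fun n => by simp⟩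

theorem add {b b' : ℕ → ℕ} (h : IsPoly b) (h' : IsPoly b') : IsPoly fun n => b n + b' n := by
  obtain ⟨T, hT⟩ := h
  obtain ⟨T', hT'⟩ := h'
  exact ⟨T + T', fun n => by simp [hT, hT']⟩

theorem mul {b b' : ℕ → ℕ} (h : IsPoly b) (h' : IsPoly b') : IsPoly fun n => b n * b' n := by
  obtain ⟨T, hT⟩ := h
  obtain ⟨T', hT'⟩ := h'
  exact ⟨T * T', fun n => by simp [hT, hT']⟩

theorem forBound {b : ℕ → ℕ} (h : IsPoly b) : IsPoly fun n => RealRAM.forBound n (b n) :=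
  (id.mul (h.add (const 9))).add (const 7)

theorem bound (P : Prog) : IsPoly fun n => P.bound n := by
  induction P with
  | skip => exact const _
  | setNat v e => exact const _
  | setReal r i e => exact const _
  | setBit x i => exact const _
  | clearBit x i => exact const _
  | queryValue x r i => exact ((const _).add id).add (const 1)
  | queryDemand r x => exact id.add (const 1)
  | seq P Q ihP ihQ => exact ihP.add ihQ
  | ite b P Q ihP ihQ => exact (const _).add (ihP.add ihQ)
  | _ b P => exact const 0

end IsPoly

end RealRAM

/-! ## The algorithm

Counters: `0` holds `n`, `1` and `2` are loop counters. Real arrays: `0` costs, `1` accuracy `a`,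
`2` scratch, `3` prices, `4` the utility of the best team so far, `5` the largest value of a cheap
agent, `6` the value of all agents, `7` the guess of the value of a team, `8` the truncation level.
Bit arrays: `0` best team so far, `1` current team, `2` cheap agents, `3` all agents. -/

namespace RealRAM

/-- Cell `0` of a real array. -/
def scalar (r : ℕ) : RExpr := .cell r (.const 0)

/-- Overwrite cell `0` of a real array. -/
def setScalar (r : ℕ) (e : RExpr) : Prog := .setReal r (.const 0) e

/-- Add the share of the agent in counter `2` to the total share in cell `2` of the scratch array,
if the agent belongs to the current team; cell `0` holds the value of the team. -/
def addShare : Prog :=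
  .ite (.mem (.var 2) 1)
    (.seq (.clearBit 1 (.var 2)) <| .seq (.queryValue 1 2 (.const 1)) <|
      .seq (.setBit 1 (.var 2)) <|
      .seq (.setReal 2 (.const 1) (.sub (scalar 2) (.cell 2 (.const 1)))) <|
      .ite (.realLe (.cell 2 (.const 1)) (.const 0))
        (.setReal 2 (.const 2) (.add (.cell 2 (.const 2)) (.const 2)))
        (.setReal 2 (.const 2)
          (.add (.cell 2 (.const 2)) (.div (.cell 0 (.var 2)) (.cell 2 (.const 1))))))
    .skip

/-- Copy one bit of the current team to the best team. -/
def copyBit : Prog := .ite (.mem (.var 2) 1) (.setBit 0 (.var 2)) (.clearBit 0 (.var 2))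

/-- Initialize the computation of the total share of the current team. -/
def initShare : Prog :=
  .seq (.setReal 2 (.const 2) (.const 0)) (.queryValue 1 2 (.const 0))

/-- Compute the utility of the current team from its value and its total share. -/
def computeUtility : Prog :=
  setScalar 2 (.mul (.sub (.const 1) (.cell 2 (.const 2))) (scalar 2))

/-- Record the current team if it is feasible and at least as good as the best team so far. -/
def evaluate : Prog :=
  .seq initShare <| .seq (forLoop 2 addShare) <| .seq computeUtility <|
  .ite (.and (.realLe (.cell 2 (.const 2)) (.const 1)) (.realLe (scalar 4) (scalar 2)))
    (.seq (setScalar 4 (scalar 2)) (forLoop 2 copyBit))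
    .skip

/-- Remove the agent in counter `2` from the current team and restart if the marginal of the agent
is below `q` times the price; otherwise proceed to the next agent. -/
def pruneStep (q : ℚ) : Prog :=
  .ite (.mem (.var 2) 1)
    (.seq (.queryValue 1 2 (.const 0)) <| .seq (.clearBit 1 (.var 2)) <|
      .seq (.queryValue 1 2 (.const 1)) <|
      .ite (.realLe (.mul (.const q) (.cell 3 (.var 2))) (.sub (scalar 2) (.cell 2 (.const 1))))
        (.seq (.setBit 1 (.var 2)) (.setNat 2 (.add (.var 2) (.const 1))))
        (.setNat 2 (.const 0)))
    (.setNat 2 (.add (.var 2) (.const 1)))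

/-- Remove agents from the current team until all marginals are at least `q` times the prices. -/
def prune (q : ℚ) : Prog :=
  .seq (.setNat 2 (.const 0)) <|
    .while (.natLe (.add (.var 2) (.const 1)) (.var 0)) (pruneStep q)

/-- Remove the agent in counter `2` if the value of the current team is at least the level. -/
def truncateStep : Prog :=
  .seq (.queryValue 1 2 (.const 0)) <|
    .ite (.realLe (scalar 8) (scalar 2)) (.clearBit 1 (.var 2)) .skip

/-- Set the price of the agent in counter `2`. -/
def setPrice : Prog :=
  .ite (.mem (.var 2) 2)
    (.setReal 3 (.var 2)
      (.mul (.mul (.div (scalar 1) (.const 2)) (.sqrt (scalar 7))) (.sqrt (.cell 0 (.var 2)))))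
    (.setReal 3 (.var 2) (.add (scalar 6) (.const 1)))

/-- Increase the guess. -/
def nextGuess : Prog := setScalar 7 (.add (scalar 7) (scalar 5))

/-- Set the truncation level that belongs to the guess. -/
def setLevel : Prog :=
  setScalar 8 (.div (.mul (.mul (scalar 1) (scalar 1)) (scalar 7)) (.const 16))

/-- Evaluate the candidate team for the next guess. -/
def tryGuess : Prog :=
  .seq nextGuess <| .seq (forLoop 2 setPrice) <| .seq (.queryDemand 3 1) <|
  .seq (prune 1) <| .seq setLevel <| .seq (forLoop 2 truncateStep) <|
  .seq (prune (1 / 2)) evaluate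

/-- Make the agent in counter `1` the current team, and register the agent if it is cheap. -/
def register : Prog :=
  .seq (.setBit 3 (.var 1)) <| .seq (.setBit 1 (.var 1)) <|
  .seq (.queryValue 1 2 (.const 3)) <|
  .ite (.realLe (.add (.cell 0 (.var 1)) (.cell 0 (.var 1))) (.cell 2 (.const 3)))
    (.seq (.setBit 2 (.var 1)) <|
      .ite (.realLe (scalar 5) (.cell 2 (.const 3))) (setScalar 5 (.cell 2 (.const 3))) .skip)
    .skip

/-- Evaluate the agent in counter `1` as a team. -/
def trySingleton : Prog := .seq register (.seq evaluate (.clearBit 1 (.var 1)))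

/-- The approximation algorithm. -/
def algorithm : Prog :=
  .seq (forLoop 1 trySingleton) <| .seq (.queryValue 3 6 (.const 0)) (forLoop 1 tryGuess)

/-! ### Specifications -/

variable {n : ℕ} (I : ContractSetting n)

/-- The store holds a feasible team together with its utility. -/
def HoldsBest (s : Store) : Prop :=
  I.Feasible (s.agents n 0) ∧ I.realUtility (s.agents n 0) = s.real 4 0

/-- The store `s'` holds a feasible team that is at least as good as the one in `s` and as `U`,
if `U` is feasible. -/
def Improves (U : Finset (Fin n)) (s s' : Store) : Prop :=
  HoldsBest I s' ∧ s.real 4 0 ≤ s'.real 4 0 ∧ (I.Feasible U → I.realUtility U ≤ s'.real 4 0)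

/-- The agents of a team below a bound. -/
def below (S : Finset (Fin n)) (j : ℕ) : Finset (Fin n) := S.filter fun i => (i : ℕ) < j

theorem below_zero (S : Finset (Fin n)) : below S 0 = ∅ := by simp [below]

theorem below_card (S : Finset (Fin n)) : below S n = S := by simp [below]

theorem below_succ_of_mem {S : Finset (Fin n)} {i : Fin n} (hi : i ∈ S) :
    below S (i + 1) = insert i (below S i) := by
  ext j
  simp only [below, Finset.mem_filter, Finset.mem_insert, Fin.ext_iff]
  constructor
  · rintro ⟨h1, h2⟩
    rcases Nat.lt_succ_iff_lt_or_eq.1 h2 with h | h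
    · exact .inr ⟨h1, h⟩
    · exact .inl h
  · rintro (h | ⟨h1, h2⟩)
    · exact ⟨Fin.ext h ▸ hi, by omega⟩
    · exact ⟨h1, by omega⟩

theorem below_succ_of_notMem {S : Finset (Fin n)} {i : Fin n} (hi : i ∉ S) :
    below S (i + 1) = below S i := by
  ext j
  simp only [below, Finset.mem_filter]
  refine and_congr_right fun hj => ⟨fun h => ?_, fun h => by omega⟩
  have : (j : ℕ) ≠ i := fun e => hi (Fin.ext e ▸ hj)
  omega

theorem notMem_below (S : Finset (Fin n)) (i : Fin n) : i ∉ below S i := by simp [below]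

variable {I} {D : (Fin n → ℝ) → Finset (Fin n)} {s : Store}

/-- A bound on the number of steps of `evaluate`. -/
def evaluateBound (n : ℕ) : ℕ :=
  initShare.bound n + (forBound n (addShare.bound n) + (computeUtility.bound n +
    (10 + (((setScalar 4 (scalar 2)).bound n + forBound n (copyBit.bound n)) + 1))))

theorem halts_shares (h0 : s.nat 0 = n) (hc : ∀ i : Fin n, s.real 0 i = I.c i)
    (hf : s.real 2 0 = I.f (s.agents n 1)) (hr : s.real 2 2 = 0) :
    Halts ⟨I.f, D⟩ (forLoop 2 addShare) s (forBound n (addShare.bound n)) fun s' =>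
      s'.agents n 1 = s.agents n 1 ∧ s'.real 2 0 = I.f (s.agents n 1) ∧
        s'.real 2 2 = I.realTotalShare (s.agents n 1) := by
  set X := s.agents n 1 with hX
  refine (Halts.forLoop (J := fun j s => s.agents n 1 = X ∧ s.real 2 0 = I.f X ∧
    (∀ i : Fin n, s.real 0 i = I.c i) ∧ s.real 2 2 = ∑ i ∈ below X j, I.realShare i X)
    h0 (by decide) (by simp [addShare, Prog.WritesNat]) (by simp [addShare, Prog.WritesNat])
    ⟨by simp [hX], by simpa using hf, by simpa using hc, by simpa [below_zero] using hr⟩ ?_).imp ?_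
  · rintro i s - hi ⟨h1, h2, h3, h4⟩
    refine Halts.of_loopFree (by simp [addShare, Prog.LoopFree]) ?_
    have hmem : i ∈ X ↔ (i : ℕ) ∈ s.bits 1 := by rw [← h1, Store.mem_agents]
    by_cases hiX : i ∈ X
    · have hb := hmem.1 hiX
      have hm : I.marginal i X = I.f X - I.f (X.erase i) := I.marginal_of_mem hiX
      rw [below_succ_of_mem hiX, Finset.sum_insert (notMem_below X i), ContractSetting.realShare]
      -- The program adds the same default `2` for a nonpositive marginal as `realShare` does.
      by_cases hpos : I.marginal i X ≤ 0
      · rw [if_pos hpos]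
        rw [hm] at hpos
        simp [addShare, Prog.run, BExpr.Holds, NExpr.eval, RExpr.eval, scalar, hi, hb, h1, h2, h3,
          h4, hpos, Finset.insert_erase hb]
        exact ⟨(Store.agents_congr (by simp)).trans h1, add_comm _ _⟩
      · rw [if_neg hpos]
        rw [hm] at hpos ⊢
        simp [addShare, Prog.run, BExpr.Holds, NExpr.eval, RExpr.eval, scalar, hi, hb, h1, h2, h3,
          h4, hpos, Finset.insert_erase hb]
        exact ⟨(Store.agents_congr (by simp)).trans h1, add_comm _ _⟩
    · have hb := mt hmem.2 hiX
      simp [addShare, Prog.run, BExpr.Holds, NExpr.eval, hi, hb, h1, h2, h3, h4,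
        below_succ_of_notMem hiX]
  · rintro s' - ⟨h1, h2, -, h4⟩
    exact ⟨h1, h2, by rw [h4, below_card]; rfl⟩

/-- Positions from `n` on are not copied; `agents` ignores them. -/
theorem halts_copy (h0 : s.nat 0 = n) :
    Halts ⟨I.f, D⟩ (forLoop 2 copyBit) s (forBound n (copyBit.bound n)) fun s' =>
      s'.agents n 0 = s.agents n 1 := by
  refine (Halts.forLoop (J := fun j s' => s'.bits 1 = s.bits 1 ∧
    ∀ i : Fin n, (i : ℕ) < j → ((i : ℕ) ∈ s'.bits 0 ↔ (i : ℕ) ∈ s.bits 1))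
    h0 (by decide) (by simp [copyBit, Prog.WritesNat]) (by simp [copyBit, Prog.WritesNat])
    ⟨by simp, by simp⟩ ?_).imp ?_
  · rintro i s₁ - hi ⟨h1, h2⟩
    refine Halts.of_loopFree (by simp [copyBit, Prog.LoopFree]) ?_
    have key : ∀ j : Fin n, (j : ℕ) < i + 1 → (j : ℕ) ≠ i →
        ((j : ℕ) ∈ s₁.bits 0 ↔ (j : ℕ) ∈ s.bits 1) := fun j hj hne => h2 j (by omega)
    by_cases hb : (i : ℕ) ∈ s.bits 1
    · simp only [copyBit, Prog.run, BExpr.Holds, NExpr.eval, hi, h1, hb, if_true]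
      refine ⟨by simp [h1], fun j hj => ?_⟩
      by_cases hji : (j : ℕ) = i
      · simp [hji, hb]
      · simpa [hji] using key j hj hji
    · simp only [copyBit, Prog.run, BExpr.Holds, NExpr.eval, hi, h1, hb, if_false]
      refine ⟨by simp [h1], fun j hj => ?_⟩
      by_cases hji : (j : ℕ) = i
      · simp [hji, hb]
      · simpa [hji] using key j hj hji
  · rintro s' - ⟨-, h⟩
    ext i
    simpa using h i i.2

theorem halts_evaluate (h0 : s.nat 0 = n) (hc : ∀ i : Fin n, s.real 0 i = I.c i)
    (hbest : HoldsBest I s) :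
    Halts ⟨I.f, D⟩ evaluate s (evaluateBound n) fun s' =>
      s'.agents n 1 = s.agents n 1 ∧ Improves I (s.agents n 1) s s' := by
  set X := s.agents n 1 with hX
  refine Halts.seq (Halts.of_loopFree (by simp [initShare, Prog.LoopFree]) ?_)
  set s₁ := initShare.run ⟨I.f, D⟩ s with hs₁
  have hs₁X : s₁.agents n 1 = X := by simp [hs₁, initShare, Prog.run, hX]
  have hs₁0 : s₁.agents n 0 = s.agents n 0 := by simp [hs₁, initShare, Prog.run]
  have hs₁4 : s₁.real 4 0 = s.real 4 0 := by simp [hs₁, initShare, Prog.run]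
  refine Halts.seq ((halts_shares (by simp [hs₁, initShare, Prog.run, h0])
    (by simp [hs₁, initShare, Prog.run, hc])
    (by rw [hs₁X]; simp [hs₁, initShare, Prog.run, NExpr.eval, hX])
    (by simp [hs₁, initShare, Prog.run, NExpr.eval, RExpr.eval])).imp ?_)
  rintro s₂ hfr ⟨h21, h22, h23⟩
  have hs₂0 : s₂.agents n 0 = s.agents n 0 := by
    rw [hfr.agents n (by simp [addShare, forLoop, Prog.WritesBits]), hs₁0]
  have hs₂4 : s₂.real 4 0 = s.real 4 0 := by
    rw [hfr.real 4 (by simp [addShare, forLoop, Prog.WritesReal]), hs₁4]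
  have hs₂n : s₂.nat 0 = n := by
    rw [hfr.nat 0 (by simp [addShare, forLoop, Prog.WritesNat])]
    simp [hs₁, initShare, Prog.run, h0]
  rw [hs₁X] at h21 h22 h23
  refine Halts.seq (Halts.of_loopFree (by simp [computeUtility, setScalar, Prog.LoopFree]) ?_)
  have e : computeUtility.run ⟨I.f, D⟩ s₂ = s₂.setReal 2 0 (I.realUtility X) := by
    simp [computeUtility, setScalar, scalar, Prog.run, NExpr.eval, RExpr.eval, h22, h23,
      ContractSetting.realUtility]
  rw [e]
  set s₃ := s₂.setReal 2 0 (I.realUtility X) with hs₃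
  refine Halts.ite (fun hb => Halts.seq (Halts.of_loopFree
    (by simp [setScalar, Prog.LoopFree]) ?_)) (fun hb => ⟨1, _, .skip _, le_rfl, ?_⟩)
  · simp [BExpr.Holds, RExpr.eval, scalar, NExpr.eval, hs₃, h23, hs₂4] at hb
    refine (halts_copy (by simp [setScalar, Prog.run, hs₃, hs₂n])).imp ?_
    intro s' hfr' h0'
    have hX' : s'.agents n 1 = X := by
      rw [hfr'.agents n (by simp [copyBit, forLoop, Prog.WritesBits])]
      simpa [setScalar, Prog.run, hs₃] using h21
    have h4' : s'.real 4 0 = I.realUtility X := by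
      rw [hfr'.real 4 (by simp [copyBit, forLoop, Prog.WritesReal])]
      simp [setScalar, scalar, Prog.run, NExpr.eval, RExpr.eval, hs₃]
    have h0X : s'.agents n 0 = X := by
      rw [h0']
      simpa [setScalar, Prog.run, hs₃] using h21
    refine ⟨hX', ⟨?_, ?_⟩, ?_, fun _ => h4'.ge⟩
    · rw [h0X]
      exact ContractSetting.feasible_iff.2 hb.1
    · rw [h0X, h4']
    · rw [h4']
      exact hb.2
  · have h4' : s₃.real 4 0 = s.real 4 0 := by simp [hs₃, hs₂4]
    have h0' : s₃.agents n 0 = s.agents n 0 := by simp [hs₃, hs₂0]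
    refine ⟨by simpa [hs₃] using h21, ⟨?_, ?_⟩, h4'.ge, fun hX => ?_⟩
    · rw [h0']
      exact hbest.1
    · rw [h0', h4']
      exact hbest.2
    · simp [BExpr.Holds, RExpr.eval, scalar, NExpr.eval, hs₃, h23, hs₂4] at hb
      rw [h4']
      exact (hb (ContractSetting.feasible_iff.1 hX)).le

/-- A bound on the number of steps of `prune`. -/
def pruneBound (q : ℚ) (n : ℕ) : ℕ := 2 + ((n * (n + 1) + n) * (5 + (pruneStep q).bound n) + 5)

/-- Removing an agent whose marginal is below its price raises value minus price. XOS functions need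
not be submodular, so a removal can lower other marginals; hence the scan restarts, and agents below
the counter are those known to pass. -/
theorem halts_prune (q : ℚ) {p : Fin n → ℝ} (h0 : s.nat 0 = n)
    (hp : ∀ i : Fin n, s.real 3 i = p i) :
    Halts ⟨I.f, D⟩ (prune q) s (pruneBound q n) fun s' =>
      I.IsPruned (fun i => q * p i) (s.agents n 1) (s'.agents n 1) := by
  set X := s.agents n 1 with hX
  refine Halts.seq (B := 2) ⟨2, _, .setNat s 2 (.const 0), le_rfl, ?_⟩
  -- A restart raises `n` minus the counter by at most `n`, while the smaller team lowers the
  -- measure by `n + 1`.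
  have hloop := Halts.while_of_measure (O := ⟨I.f, D⟩) (P := pruneStep q)
    (B := (pruneStep q).bound n) (s := s.setNat 2 0)
    (b := .natLe (.add (.var 2) (.const 1)) (.var 0))
    (J := fun s => s.nat 0 = n ∧ s.nat 2 ≤ n ∧ (∀ i : Fin n, s.real 3 i = p i) ∧
      s.agents n 1 ⊆ X ∧
      (I.f X - additiveCost (fun i => q * p i) X ≤
        I.f (s.agents n 1) - additiveCost (fun i => q * p i) (s.agents n 1)) ∧
      ∀ i ∈ s.agents n 1, (i : ℕ) < s.nat 2 → q * p i ≤ I.marginal i (s.agents n 1))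
    (fun s => (s.agents n 1).card * (n + 1) + (n - s.nat 2))
    ⟨by simp [h0], by simp, by simpa using hp, by simp [hX], by simp [hX], by simp⟩ ?_
  · refine (hloop.bound_mono ?_).imp ?_
    · have : ((s.setNat 2 0).agents n 1).card ≤ n := by
        simpa using Finset.card_le_univ ((s.setNat 2 0).agents n 1)
      simp only [BExpr.cost, NExpr.cost]
      gcongr
      omega
    · rintro s' - ⟨⟨h1, h2, h3, h4, h5, h6⟩, hb⟩
      simp only [BExpr.Holds, NExpr.eval, h1, not_le] at hb
      exact ⟨h4, fun i hi => h6 i hi (by omega), h5⟩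
  · rintro s₁ ⟨h1, h2, h3, h4, h5, h6⟩ hb
    simp only [BExpr.Holds, NExpr.eval, h1] at hb
    obtain ⟨i, hi⟩ : ∃ i : Fin n, s₁.nat 2 = i := ⟨⟨s₁.nat 2, hb⟩, rfl⟩
    have hin := i.2
    set Y := s₁.agents n 1 with hY
    have hlt : ∀ j ∈ Y, (j : ℕ) < i → q * p j ≤ I.marginal j Y := fun j hj hji =>
      h6 j hj (hi ▸ hji)
    suffices h : Halts ⟨I.f, D⟩ (pruneStep q) s₁ ((pruneStep q).bound n) fun s' =>
        (s'.nat 2 = i + 1 ∧ s'.agents n 1 = Y ∧ (i ∈ Y → q * p i ≤ I.marginal i Y)) ∨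
        (s'.nat 2 = 0 ∧ s'.agents n 1 = Y.erase i ∧ i ∈ Y ∧ I.marginal i Y < q * p i) by
      refine h.imp fun s' hfr hs' => ?_
      have h1' : s'.nat 0 = n := (hfr.nat 0 (by simp [pruneStep, Prog.WritesNat])).trans h1
      have h3' : ∀ i : Fin n, s'.real 3 i = p i := by
        rwa [hfr.real 3 (by simp [pruneStep, Prog.WritesReal])]
      rcases hs' with ⟨e2, eY, hiY⟩ | ⟨e2, eY, hiY, hm⟩
      · rw [eY, e2, hi]
        refine ⟨⟨h1', hin, h3', h4, h5, fun j hj hji => ?_⟩, by omega⟩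
        rcases Nat.lt_succ_iff_lt_or_eq.1 hji with h | h
        · exact hlt j hj h
        · rw [Fin.ext h] at hj ⊢
          exact hiY hj
      · rw [eY, e2, hi]
        have hcard := Finset.card_erase_add_one hiY
        have hcost := Finset.add_sum_erase Y (fun i => q * p i) hiY
        rw [I.marginal_of_mem hiY] at hm
        refine ⟨⟨h1', Nat.zero_le _, h3', (Finset.erase_subset i Y).trans h4, ?_, ?_⟩, ?_⟩
        · simp only [additiveCost] at h5 ⊢
          linarith
        · exact fun _ _ h => absurd h (Nat.not_lt_zero _)
        · rw [← hcard, add_mul]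
          omega
    refine Halts.of_loopFree (by simp [pruneStep, Prog.LoopFree]) ?_
    have hmem : (i : ℕ) ∈ s₁.bits 1 ↔ i ∈ Y := by rw [hY, Store.mem_agents]
    have herase : ∀ y, ((s₁.setReal 2 0 y).setBits 1 ((s₁.bits 1).erase i)).agents n 1 =
        Y.erase i := fun y => Store.agents_setBits_erase (s := s₁.setReal 2 0 y) 1 i
    by_cases hiY : i ∈ Y
    · have hbit := hmem.2 hiY
      rw [I.marginal_of_mem hiY]
      by_cases hle : q * p i ≤ I.f Y - I.f (Y.erase i)
      · left
        simp [pruneStep, scalar, Prog.run, BExpr.Holds, NExpr.eval, RExpr.eval, hi, hbit, ← hY,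
          h3, herase, hle, Finset.insert_erase hbit]
        exact Store.agents_congr (by simp)
      · right
        simp [pruneStep, scalar, Prog.run, BExpr.Holds, NExpr.eval, RExpr.eval, hi, hbit, ← hY,
          h3, herase, hle, hiY, not_le.1 hle]
    · left
      simp [pruneStep, Prog.run, BExpr.Holds, NExpr.eval, hi, hmem, hiY, ← hY]

/-- One pass suffices: either the value has reached the level, or every agent scanned so far is
gone, which at the end means the empty team. An agent is removed only at value at least `t`, so by
subadditivity at least `t - f {i}` remains. -/
theorem halts_truncate (hf : IsXOS I.f) {t : ℝ} (h0 : s.nat 0 = n) (ht : s.real 8 0 = t) :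
    Halts ⟨I.f, D⟩ (forLoop 2 truncateStep) s (forBound n (truncateStep.bound n)) fun s' =>
      I.IsTruncated t (s.agents n 1) (s'.agents n 1) := by
  set X := s.agents n 1 with hX
  refine (Halts.forLoop (J := fun j s' => s'.real 8 0 = t ∧ s'.agents n 1 ⊆ X ∧
      (s'.agents n 1 = X ∨ ∃ i ∈ X, t - I.f {i} ≤ I.f (s'.agents n 1)) ∧
      (I.f (s'.agents n 1) ≤ t ∨ ∀ i ∈ s'.agents n 1, j ≤ (i : ℕ)))
    h0 (by decide) (by simp [truncateStep, Prog.WritesNat])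
    (by simp [truncateStep, Prog.WritesNat])
    ⟨by simpa using ht, by simp [hX], .inl (by simp [hX]), .inr (by simp)⟩ ?_).imp ?_
  · rintro i s₁ - hi ⟨h1, h2, h3, h4⟩
    refine Halts.of_loopFree (by simp [truncateStep, Prog.LoopFree]) ?_
    set Y := s₁.agents n 1 with hY
    by_cases hle : t ≤ I.f Y
    · have e : ((truncateStep.run ⟨I.f, D⟩ s₁).setNat 2 (i + 1)).agents n 1 = Y.erase i := by
        simp [truncateStep, scalar, Prog.run, BExpr.Holds, NExpr.eval, RExpr.eval, hi, ← hY, h1,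
          hle]
        exact Store.agents_setBits_erase (s := s₁.setReal 2 0 (I.f Y)) 1 i
      simp only [e]
      refine ⟨by simp [truncateStep, scalar, Prog.run, BExpr.Holds, NExpr.eval, RExpr.eval, ← hY,
        h1, hle], (Finset.erase_subset i Y).trans h2, ?_, ?_⟩
      · by_cases hiY : i ∈ Y
        · have := hf.le_erase_add_singleton hiY
          exact .inr ⟨i, h2 hiY, by linarith⟩
        · rwa [Finset.erase_eq_of_notMem hiY]
      · rcases h4 with h4 | h4
        · exact .inl ((I.f_mono _ _ (Finset.erase_subset i Y)).trans h4)
        · refine .inr fun j hj => ?_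
          have h := h4 j (Finset.mem_of_mem_erase hj)
          have hne : (j : ℕ) ≠ i := fun h => Finset.ne_of_mem_erase hj (Fin.ext h)
          omega
    · have e : ((truncateStep.run ⟨I.f, D⟩ s₁).setNat 2 (i + 1)).agents n 1 = Y := by
        simp [truncateStep, scalar, Prog.run, BExpr.Holds, NExpr.eval, RExpr.eval, ← hY, h1, hle]
      simp only [e]
      exact ⟨by simp [truncateStep, scalar, Prog.run, BExpr.Holds, NExpr.eval, RExpr.eval, ← hY,
        h1, hle], h2, h3, .inl (not_le.1 hle).le⟩
  · rintro s' - ⟨-, h2, h3, h4⟩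
    refine ⟨h2, h4.imp_right fun h => Finset.eq_empty_of_forall_notMem fun i hi => ?_, h3⟩
    have := h i hi
    omega

theorem halts_prices {a x : ℝ} {A : Finset (Fin n)} (h0 : s.nat 0 = n)
    (hc : ∀ i : Fin n, s.real 0 i = I.c i) (ha : s.real 1 0 = a) (hx : s.real 7 0 = x)
    (hA : s.agents n 2 = A) (hH : s.real 6 0 = I.f Finset.univ) :
    Halts ⟨I.f, D⟩ (forLoop 2 setPrice) s (forBound n (setPrice.bound n)) fun s' =>
      s'.vector n 3 = I.prices a x A := by
  refine (Halts.forLoop (J := fun j s' => (∀ i : Fin n, s'.real 0 i = I.c i) ∧ s'.real 1 0 = a ∧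
      s'.real 7 0 = x ∧ s'.agents n 2 = A ∧ s'.real 6 0 = I.f Finset.univ ∧
      ∀ i : Fin n, (i : ℕ) < j → s'.real 3 i = I.prices a x A i)
    h0 (by decide) (by simp [setPrice, Prog.WritesNat]) (by simp [setPrice, Prog.WritesNat])
    ⟨by simpa using hc, by simpa using ha, by simpa using hx, by simpa using hA, by simpa using hH,
      by simp⟩ ?_).imp ?_
  · rintro i s₁ - hi ⟨h1, h2, h3, h4, h5, h6⟩
    refine Halts.of_loopFree (by simp [setPrice, Prog.LoopFree]) ?_
    have hmem : (i : ℕ) ∈ s₁.bits 2 ↔ i ∈ A := by rw [← h4, Store.mem_agents]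
    have e : setPrice.run ⟨I.f, D⟩ s₁ = s₁.setReal 3 i (I.prices a x A i) := by
      by_cases hiA : i ∈ A <;>
        simp [setPrice, scalar, Prog.run, BExpr.Holds, NExpr.eval, RExpr.eval, hi, h1, h2, h3, h5,
          hmem, hiA, ContractSetting.prices]
    rw [e]
    refine ⟨by simpa using h1, by simpa using h2, by simpa using h3, by simpa using h4,
      by simpa using h5, fun j hj => ?_⟩
    by_cases hji : (j : ℕ) = i
    · simp [Fin.ext hji]
    · simpa [hji] using h6 j (by omega)
  · rintro s' - ⟨-, -, -, -, -, h⟩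
    exact funext fun i => h i i.2

end RealRAM

/-! ### Correctness of the guesses, of the singleton loop and of the algorithm -/

namespace RealRAM

variable {n : ℕ} {I : ContractSetting n} {D : (Fin n → ℝ) → Finset (Fin n)} {s : Store}

/-- A bound on the number of steps of `tryGuess`. -/
def tryGuessBound (n : ℕ) : ℕ :=
  nextGuess.bound n + (forBound n (setPrice.bound n) + ((Prog.queryDemand 3 1).bound n +
    (pruneBound 1 n + (setLevel.bound n + (forBound n (truncateStep.bound n) +
      (pruneBound (1 / 2) n + evaluateBound n))))))

theorem halts_tryGuess (hf : IsXOS I.f) {a x M : ℝ} {A : Finset (Fin n)} (h0 : s.nat 0 = n)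
    (hc : ∀ i : Fin n, s.real 0 i = I.c i) (ha : s.real 1 0 = a) (hM : s.real 5 0 = M)
    (hx : s.real 7 0 + M = x) (hA : s.agents n 2 = A) (hH : s.real 6 0 = I.f Finset.univ)
    (hbest : HoldsBest I s) :
    Halts ⟨I.f, D⟩ tryGuess s (tryGuessBound n) fun s' =>
      s'.real 7 0 = x ∧ ∃ U,
        I.IsCandidate (I.prices a x A) (a * a * x / 16) (D (I.prices a x A)) U ∧
          Improves I U s s' := by
  refine Halts.seq (Halts.of_loopFree (by simp [nextGuess, setScalar, Prog.LoopFree]) ?_)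
  have e₁ : nextGuess.run ⟨I.f, D⟩ s = s.setReal 7 0 x := by
    simp [nextGuess, setScalar, scalar, Prog.run, NExpr.eval, RExpr.eval, hM, hx]
  rw [e₁]
  refine Halts.seq ((halts_prices (I := I) (a := a) (x := x) (A := A) (by simpa using h0)
    (by simpa using hc) (by simpa using ha) (by simp) (by simpa using hA)
    (by simpa using hH)).imp fun s₂ hfr₂ h₂ => ?_)
  refine Halts.seq (Halts.of_loopFree (by simp [Prog.LoopFree]) ?_)
  set p := I.prices a x A with hp
  have e₃ : (Prog.queryDemand 3 1).run ⟨I.f, D⟩ s₂ = s₂.setBits 1 ((D p).map Fin.valEmbedding) := by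
    simp [Prog.run, h₂]
  rw [e₃]
  -- From here on, `n`, `r` and `b` with a stage index record that the counter `0`, the real arrays
  -- and the bit arrays survive that stage.
  have n₂ : s₂.nat 0 = n := by
    rw [hfr₂.nat 0 (by simp [setPrice, forLoop, Prog.WritesNat])]
    simpa using h0
  have r₂ : ∀ r, r ≠ 3 → s₂.real r = (s.setReal 7 0 x).real r := fun r hr =>
    hfr₂.real r (by simpa [setPrice, forLoop, Prog.WritesReal] using hr)
  have b₂ : s₂.bits = s.bits := by
    funext y
    rw [hfr₂.bits y (by simp [setPrice, forLoop, Prog.WritesBits]), Store.bits_setReal]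
  refine Halts.seq ((halts_prune 1 (p := p) (by simpa using n₂)
    (by simpa [Store.vector] using fun i => congrFun h₂ i)).imp fun s₄ hfr₄ h₄ => ?_)
  rw [Store.agents_setBits_map] at h₄
  have n₄ : s₄.nat 0 = n := by
    rw [hfr₄.nat 0 (by simp [prune, pruneStep, Prog.WritesNat])]
    simpa using n₂
  have r₄ : ∀ r, r ≠ 2 → s₄.real r = s₂.real r := fun r hr =>
    hfr₄.real r (by simpa [prune, pruneStep, Prog.WritesReal] using hr)
  have b₄ : ∀ y, y ≠ 1 → s₄.bits y = s.bits y := fun y hy => by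
    rw [hfr₄.bits y (by simpa [prune, pruneStep, Prog.WritesBits] using hy)]
    simp [hy, b₂]
  refine Halts.seq (Halts.of_loopFree (by simp [setLevel, setScalar, Prog.LoopFree]) ?_)
  have e₅ : setLevel.run ⟨I.f, D⟩ s₄ = s₄.setReal 8 0 (a * a * x / 16) := by
    simp [setLevel, setScalar, scalar, Prog.run, NExpr.eval, RExpr.eval, r₄, r₂, ha]
  rw [e₅]
  refine Halts.seq ((halts_truncate hf (by simpa using n₄)
    (t := a * a * x / 16) (by simp)).imp fun s₆ hfr₆ h₆ => ?_)
  rw [Store.agents_setReal] at h₆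
  have n₆ : s₆.nat 0 = n := by
    rw [hfr₆.nat 0 (by simp [truncateStep, forLoop, Prog.WritesNat])]
    simpa using n₄
  have r₆ : ∀ r, r ≠ 2 → s₆.real r = (s₄.setReal 8 0 (a * a * x / 16)).real r := fun r hr =>
    hfr₆.real r (by simpa [truncateStep, forLoop, Prog.WritesReal] using hr)
  have b₆ : ∀ y, y ≠ 1 → s₆.bits y = s.bits y := fun y hy => by
    rw [hfr₆.bits y (by simpa [truncateStep, forLoop, Prog.WritesBits] using hy)]
    simp [b₄ y hy]
  refine Halts.seq ((halts_prune (1 / 2) (p := p) n₆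
    (by simpa [r₆, r₄, Store.vector] using fun i => congrFun h₂ i)).imp fun s₇ hfr₇ h₇ => ?_)
  have n₇ : s₇.nat 0 = n := by
    rw [hfr₇.nat 0 (by simp [prune, pruneStep, Prog.WritesNat]), n₆]
  have r₇ : ∀ r, r ≠ 2 → s₇.real r = s₆.real r := fun r hr =>
    hfr₇.real r (by simpa [prune, pruneStep, Prog.WritesReal] using hr)
  have b₇ : ∀ y, y ≠ 1 → s₇.bits y = s.bits y := fun y hy => by
    rw [hfr₇.bits y (by simpa [prune, pruneStep, Prog.WritesBits] using hy), b₆ y hy]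
  have best₇ : s₇.real 4 0 = s.real 4 0 := by simp [r₇, r₆, r₄, r₂]
  have ag₇ : s₇.agents n 0 = s.agents n 0 := Store.agents_congr (b₇ 0 (by decide))
  refine (halts_evaluate n₇ (by simpa [r₇, r₆, r₄, r₂] using hc)
    ⟨ag₇ ▸ hbest.1, by rw [ag₇, best₇, hbest.2]⟩).imp fun s' hfr h => ⟨?_, s₇.agents n 1, ?_, ?_⟩
  · rw [hfr.real 7 (by simp [evaluate, initShare, addShare, computeUtility, setScalar, copyBit,
      forLoop, Prog.WritesReal])]
    simp [r₇, r₆, r₄, r₂]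
  · refine ⟨s₄.agents n 1, s₆.agents n 1, by simpa using h₄, h₆, by simpa using h₇⟩
  · exact ⟨h.2.1, best₇ ▸ h.2.2.1, h.2.2.2⟩

/-- A bound on the number of steps of `trySingleton`. -/
def trySingletonBound (n : ℕ) : ℕ :=
  register.bound n + (evaluateBound n + (Prog.clearBit 1 (.var 1)).bound n)

/-- The invariant of the first loop of the algorithm. -/
structure Registered (I : ContractSetting n) (j : ℕ) (s : Store) : Prop where
  cost : ∀ i : Fin n, s.real 0 i = I.c i
  best : HoldsBest I s
  current : s.agents n 1 = ∅
  all : ∀ i : Fin n, i ∈ s.agents n 3 ↔ (i : ℕ) < j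
  cheap : ∀ i : Fin n, i ∈ s.agents n 2 ↔ (i : ℕ) < j ∧ I.c i + I.c i ≤ I.f {i}
  max_nonneg : 0 ≤ s.real 5 0
  le_max : ∀ i ∈ s.agents n 2, I.f {i} ≤ s.real 5 0
  max_le : s.real 5 0 ≤ 2 * s.real 4 0
  single_le : ∀ i : Fin n, (i : ℕ) < j → I.realUtility {i} ≤ s.real 4 0

theorem halts_trySingleton {i : Fin n} (h0 : s.nat 0 = n) (hi : s.nat 1 = i)
    (h : Registered I i s) :
    Halts ⟨I.f, D⟩ trySingleton s (trySingletonBound n) (Registered I (i + 1)) := by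
  set M := s.real 5 0 with hM
  set A := s.agents n 2 with hA
  have hreg : Halts ⟨I.f, D⟩ register s (register.bound n) fun s' =>
      s'.agents n 1 = {i} ∧ s'.agents n 3 = insert i (s.agents n 3) ∧
      ((I.c i + I.c i ≤ I.f {i} ∧ s'.agents n 2 = insert i A ∧ s'.real 5 0 = max M (I.f {i})) ∨
        (¬ I.c i + I.c i ≤ I.f {i} ∧ s'.agents n 2 = A ∧ s'.real 5 0 = M)) := by
    refine Halts.of_loopFree (by simp [register, setScalar, Prog.LoopFree]) ?_
    have hcur : ∀ j : Fin n, (j : ℕ) ∉ s.bits 1 := fun j => by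
      rw [← Store.mem_agents, h.current]
      exact Finset.notMem_empty j
    have e1 : ((s.setBits 3 (insert (i : ℕ) (s.bits 3))).setBits 1
        (insert (i : ℕ) (s.bits 1))).agents n 1 = {i} := by
      ext j
      simp [Fin.ext_iff, hcur]
    by_cases hcheap : I.c i + I.c i ≤ I.f {i}
    · by_cases hMi : M ≤ I.f {i}
      · simp [register, setScalar, scalar, Prog.run, BExpr.Holds, NExpr.eval, RExpr.eval, hi, e1,
          h.cost, hcheap, ← hM, hMi]
        refine ⟨?_, ?_, ?_⟩ <;> ext j <;> simp [Fin.ext_iff, hcur, hA]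
      · simp [register, setScalar, scalar, Prog.run, BExpr.Holds, NExpr.eval, RExpr.eval, hi, e1,
          h.cost, hcheap, ← hM, hMi]
        refine ⟨?_, ?_, ?_, (not_le.1 hMi).le⟩ <;> ext j <;> simp [Fin.ext_iff, hcur, hA]
    · simp [register, setScalar, scalar, Prog.run, BExpr.Holds, NExpr.eval, RExpr.eval, hi, e1,
        h.cost, hcheap, ← hM]
      exact ⟨by ext j; simp [Fin.ext_iff], by ext j; simp [hA]⟩
  refine Halts.seq (hreg.imp fun s₁ hfr ⟨h1, h3, h2⟩ => ?_)
  have n₁ : s₁.nat 0 = n := by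
    rw [hfr.nat 0 (by simp [register, setScalar, Prog.WritesNat]), h0]
  have i₁ : s₁.nat 1 = i := by
    rw [hfr.nat 1 (by simp [register, setScalar, Prog.WritesNat]), hi]
  have c₁ : s₁.real 0 = s.real 0 :=
    hfr.real 0 (by simp [register, setScalar, Prog.WritesReal])
  have b₁ : s₁.real 4 = s.real 4 :=
    hfr.real 4 (by simp [register, setScalar, Prog.WritesReal])
  have u₁ : s₁.agents n 0 = s.agents n 0 :=
    hfr.agents n (by simp [register, setScalar, Prog.WritesBits])
  refine Halts.seq ((halts_evaluate n₁ (by rw [c₁]; exact h.cost)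
    ⟨u₁ ▸ h.best.1, by rw [u₁, b₁]; exact h.best.2⟩).imp ?_)
  rintro s₂ hfr₂ ⟨hX, best₂, le₂, hle⟩
  rw [h1] at hX hle
  rw [b₁] at le₂
  replace hle := hle (ContractSetting.feasible_singleton i)
  have i₂ : s₂.nat 1 = i := by
    rw [hfr₂.nat 1 (by simp [evaluate, initShare, addShare, computeUtility, setScalar, copyBit,
      forLoop, Prog.WritesNat]), i₁]
  have c₂ : s₂.real 0 = s.real 0 := by
    rw [hfr₂.real 0 (by simp [evaluate, initShare, addShare, computeUtility, setScalar, copyBit,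
      forLoop, Prog.WritesReal]), c₁]
  have M₂ : s₂.real 5 = s₁.real 5 :=
    hfr₂.real 5 (by simp [evaluate, initShare, addShare, computeUtility, setScalar, copyBit,
      forLoop, Prog.WritesReal])
  have A₂ : s₂.agents n 2 = s₁.agents n 2 :=
    hfr₂.agents n (by simp [evaluate, initShare, addShare, computeUtility, setScalar, copyBit,
      forLoop, Prog.WritesBits])
  have F₂ : s₂.agents n 3 = s₁.agents n 3 :=
    hfr₂.agents n (by simp [evaluate, initShare, addShare, computeUtility, setScalar, copyBit,
      forLoop, Prog.WritesBits])
  refine Halts.of_loopFree (by simp [Prog.LoopFree]) ?_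
  have e : (Prog.clearBit 1 (.var 1)).run ⟨I.f, D⟩ s₂ =
      s₂.setBits 1 ((s₂.bits 1).erase (i : ℕ)) := by
    simp [Prog.run, NExpr.eval, i₂]
  have lt_succ : ∀ j : Fin n, (j : ℕ) < i + 1 ↔ j = i ∨ (j : ℕ) < i := fun j => by
    rw [Fin.ext_iff]
    omega
  have hne : ∀ y, y ≠ 1 → (s₂.setBits 1 ((s₂.bits 1).erase (i : ℕ))).agents n y = s₂.agents n y :=
    fun y hy => Store.agents_setBits_of_ne hy _
  have hMax : 0 ≤ s₁.real 5 0 ∧ s₁.real 5 0 ≤ 2 * s₂.real 4 0 ∧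
      (∀ j, j ∈ s₁.agents n 2 ↔ (j : ℕ) < i + 1 ∧ I.c j + I.c j ≤ I.f {j}) ∧
      ∀ j ∈ s₁.agents n 2, I.f {j} ≤ s₁.real 5 0 := by
    have hMb := h.max_le
    rcases h2 with ⟨hcheap, eA, eM⟩ | ⟨hcheap, eA, eM⟩
    · rw [eA, eM]
      refine ⟨h.max_nonneg.trans (le_max_left _ _), max_le (by linarith) ?_, fun j => ?_,
        fun j hj => ?_⟩
      · rw [ContractSetting.realUtility_singleton] at hle
        linarith
      · rw [Finset.mem_insert, h.cheap, lt_succ]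
        constructor
        · rintro (rfl | ⟨h, h'⟩)
          · exact ⟨.inl rfl, hcheap⟩
          · exact ⟨.inr h, h'⟩
        · rintro ⟨h | h, h'⟩
          · exact .inl h
          · exact .inr ⟨h, h'⟩
      · rcases Finset.mem_insert.1 hj with rfl | hj
        · exact le_max_right _ _
        · exact (h.le_max j hj).trans (le_max_left _ _)
    · rw [eA, eM]
      refine ⟨h.max_nonneg, by linarith, fun j => ?_, h.le_max⟩
      rw [h.cheap, lt_succ]
      refine and_congr_left fun h' => ⟨.inr, ?_⟩
      rintro (rfl | h)
      · exact absurd h' hcheap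
      · exact h
  rw [e]
  refine ⟨?_, ⟨?_, ?_⟩, ?_, fun j => ?_, fun j => ?_, ?_, fun j hj => ?_, ?_, fun j hj => ?_⟩
  · rw [Store.real_setBits, c₂]
    exact h.cost
  · rw [hne 0 (by decide)]
    exact best₂.1
  · rw [hne 0 (by decide)]
    exact best₂.2
  · rw [Store.agents_setBits_erase, hX, Finset.erase_singleton]
  · rw [hne 3 (by decide), F₂, h3, Finset.mem_insert, h.all, lt_succ]
  · rw [hne 2 (by decide), A₂, hMax.2.2.1]
  · rw [Store.real_setBits, M₂]
    exact hMax.1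
  · rw [hne 2 (by decide), A₂] at hj
    rw [Store.real_setBits, M₂]
    exact hMax.2.2.2 j hj
  · rw [Store.real_setBits, M₂]
    exact hMax.2.1
  · rw [Store.real_setBits]
    rcases (lt_succ j).1 hj with rfl | hj
    · exact hle
    · exact (h.single_le j hj).trans le₂

theorem halts_algorithm (hf : IsXOS I.f) {a : ℝ} (ha : 0 < a) (ha1 : a ≤ 1)
    (hD : IsDemandOracle a I.f D) :
    Halts ⟨I.f, D⟩ algorithm (initStore a I.c) (forBound n (trySingletonBound n) +
      ((Prog.queryValue 3 6 (.const 0)).bound n + forBound n (tryGuessBound n))) fun s' =>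
      I.Feasible (s'.agents n 0) ∧
        I.optWelfare ≤ 188 / a ^ 2 * I.realUtility (s'.agents n 0) := by
  have hempty : ∀ x, (initStore a I.c).agents n x = ∅ := fun x => by
    ext i
    simp [initStore]
  refine Halts.seq ((Halts.forLoop (J := Registered I) (by simp [initStore]) (by decide)
    (by simp [trySingleton, register, evaluate, initShare, addShare, computeUtility, setScalar,
      copyBit, forLoop, Prog.WritesNat])
    (by simp [trySingleton, register, evaluate, initShare, addShare, computeUtility, setScalar,
      copyBit, forLoop, Prog.WritesNat]) ?_
    fun i s h0 hi h => (halts_trySingleton h0 hi h).imp fun s' _ h' => ?_).imp ?_)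
  · refine ⟨by simp [initStore], ⟨?_, ?_⟩, ?_, ?_, ?_, ?_, ?_, ?_, ?_⟩
    · simpa [hempty] using I.feasible_empty
    · rw [Store.agents_setNat, hempty, ContractSetting.realUtility_empty]
      simp [initStore]
    · exact hempty 1
    all_goals simp [initStore]
  · exact ⟨h'.cost, h'.best, h'.current, h'.all, h'.cheap, h'.max_nonneg, h'.le_max, h'.max_le,
      h'.single_le⟩
  intro s₁ hfr₁ h₁
  have n₁ : s₁.nat 0 = n := by
    rw [hfr₁.nat 0 (by simp [trySingleton, register, evaluate, initShare, addShare, computeUtility,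
      setScalar, copyBit, forLoop, Prog.WritesNat])]
    simp [initStore]
  have a₁ : s₁.real 1 0 = a := by
    rw [hfr₁.real 1 (by simp [trySingleton, register, evaluate, initShare, addShare,
      computeUtility, setScalar, copyBit, forLoop, Prog.WritesReal])]
    simp [initStore]
  have x₁ : s₁.real 7 0 = 0 := by
    rw [hfr₁.real 7 (by simp [trySingleton, register, evaluate, initShare, addShare,
      computeUtility, setScalar, copyBit, forLoop, Prog.WritesReal])]
    simp [initStore]
  have all₁ : s₁.agents n 3 = Finset.univ := by
    ext i
    simp only [h₁.all, i.2, Finset.mem_univ]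
  refine Halts.seq (Halts.of_loopFree (by simp [Prog.LoopFree]) ?_)
  have e₂ : (Prog.queryValue 3 6 (.const 0)).run ⟨I.f, D⟩ s₁ =
      s₁.setReal 6 0 (I.f Finset.univ) := by
    simp [Prog.run, NExpr.eval, all₁]
  rw [e₂]
  set A := s₁.agents n 2 with hA
  set M := s₁.real 5 0 with hM
  -- The recorded utility never decreases, so comparisons with the candidates of earlier guesses
  -- stay valid.
  refine (Halts.forLoop (J := fun k s => ((∀ i : Fin n, s.real 0 i = I.c i) ∧ s.real 1 0 = a ∧
      s.real 5 0 = M ∧ s.real 6 0 = I.f Finset.univ ∧ s.agents n 2 = A) ∧ HoldsBest I s ∧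
      s.real 7 0 = k * M ∧ s₁.real 4 0 ≤ s.real 4 0 ∧ ∀ l : ℕ, 1 ≤ l → l ≤ k → ∃ U,
        I.IsCandidate (I.prices a (l * M) A) (a * a * (l * M) / 16) (D (I.prices a (l * M) A)) U ∧
          (I.Feasible U → I.realUtility U ≤ s.real 4 0))
    (by simpa using n₁) (by decide)
    (by simp [tryGuess, nextGuess, setPrice, prune, pruneStep, setLevel, truncateStep, evaluate,
      initShare, addShare, computeUtility, setScalar, copyBit, forLoop, Prog.WritesNat])
    (by simp [tryGuess, nextGuess, setPrice, prune, pruneStep, setLevel, truncateStep, evaluate,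
      initShare, addShare, computeUtility, setScalar, copyBit, forLoop, Prog.WritesNat])
    ⟨⟨by simpa using h₁.cost, by simpa using a₁, by simp [hM], by simp, by simp [hA]⟩,
      ⟨by simpa using h₁.best.1, by simpa using h₁.best.2⟩, by simp [x₁], by simp,
      fun l h1 h2 => by omega⟩ ?_).imp ?_
  · rintro k s n₂ - ⟨⟨c₂, a₂, M₂, H₂, A₂⟩, best₂, x₂, le₂, cand₂⟩
    refine (halts_tryGuess hf n₂ c₂ a₂ M₂ (x := ((k + 1 : ℕ) : ℝ) * M)
      (by rw [x₂]; push_cast; ring) A₂ H₂ best₂).imp ?_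
    rintro s' hfr ⟨x', U, hU, best', le', hUle⟩
    have r' : ∀ r, ¬ tryGuess.WritesReal r → (s'.setNat 1 (k + 1)).real r = s.real r :=
      fun r hr => hfr.real r hr
    refine ⟨⟨?_, ?_, ?_, ?_, ?_⟩, best', x', le₂.trans le', fun l h1 h2 => ?_⟩
    · rwa [r' 0 (by simp [tryGuess, nextGuess, setPrice, prune, pruneStep, setLevel, truncateStep,
        evaluate, initShare, addShare, computeUtility, setScalar, copyBit, forLoop,
        Prog.WritesReal])]
    · rwa [r' 1 (by simp [tryGuess, nextGuess, setPrice, prune, pruneStep, setLevel, truncateStep,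
        evaluate, initShare, addShare, computeUtility, setScalar, copyBit, forLoop,
        Prog.WritesReal])]
    · rwa [r' 5 (by simp [tryGuess, nextGuess, setPrice, prune, pruneStep, setLevel, truncateStep,
        evaluate, initShare, addShare, computeUtility, setScalar, copyBit, forLoop,
        Prog.WritesReal])]
    · rwa [r' 6 (by simp [tryGuess, nextGuess, setPrice, prune, pruneStep, setLevel, truncateStep,
        evaluate, initShare, addShare, computeUtility, setScalar, copyBit, forLoop,
        Prog.WritesReal])]
    · rwa [Store.agents_setNat, hfr.agents n (by simp [tryGuess, nextGuess, setPrice, prune,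
        pruneStep, setLevel, truncateStep, evaluate, initShare, addShare, computeUtility,
        setScalar, copyBit, forLoop, Prog.WritesBits])]
    · rcases Nat.lt_succ_iff_lt_or_eq.1 (Nat.lt_succ_of_le h2) with h | h
      · obtain ⟨U', hU', hle⟩ := cand₂ l h1 (by omega)
        exact ⟨U', hU', fun hfeas => (hle hfeas).trans le'⟩
      · exact ⟨U, h ▸ hU, hUle⟩
  · rintro s' - ⟨-, best', -, le', cand'⟩
    refine ⟨best'.1, ?_⟩
    rw [best'.2]
    refine ContractSetting.optWelfare_le hf ha ha1 hD (A := A) (M := M) (fun i => ?_)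
      h₁.max_nonneg h₁.le_max (h₁.max_le.trans (by linarith))
      (fun i => (h₁.single_le i i.2).trans le') cand'
    rw [hA, h₁.cheap]
    simp

/-! ### Polynomial running time -/

theorem isPoly_evaluateBound : IsPoly evaluateBound :=
  (IsPoly.bound _).add <| (IsPoly.bound _).forBound.add <| (IsPoly.bound _).add <|
    (IsPoly.const 10).add <| ((IsPoly.bound _).add (IsPoly.bound _).forBound).add (.const 1)

theorem isPoly_pruneBound (q : ℚ) : IsPoly (pruneBound q) :=
  (IsPoly.const 2).add <| (((IsPoly.id.mul (IsPoly.id.add (.const 1))).add .id).mul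
    ((IsPoly.const 5).add (IsPoly.bound _))).add (.const 5)

theorem isPoly_tryGuessBound : IsPoly tryGuessBound :=
  (IsPoly.bound _).add <| (IsPoly.bound _).forBound.add <| (IsPoly.bound _).add <|
    (isPoly_pruneBound 1).add <| (IsPoly.bound _).add <| (IsPoly.bound _).forBound.add <|
      (isPoly_pruneBound (1 / 2)).add isPoly_evaluateBound

theorem isPoly_trySingletonBound : IsPoly trySingletonBound :=
  (IsPoly.bound _).add (isPoly_evaluateBound.add (IsPoly.bound _))

end RealRAM

/-- A single program and a single polynomial serve all settings, all accuracies `a` and all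
`a`-demand oracles; the approximation factor depends on `a` only and is `188` for `a = 1`. -/
theorem theorem1 :
    ∃ (P : RealRAM.Prog) (T : Polynomial ℕ) (C : ℝ → ℝ), C 1 = 188 ∧ (∀ a, 0 < C a) ∧
      ∀ a : ℝ, 0 < a → a ≤ 1 →
      ∀ (n : ℕ) (I : ContractSetting n), IsXOS I.f →
      ∀ D : (Fin n → ℝ) → Finset (Fin n), IsDemandOracle a I.f D →
        ∃ U : Finset (Fin n),
          RealRAM.Outputs P ⟨I.f, D⟩ a I.c (T.eval n) U ∧
          I.Feasible U ∧
          (I.optWelfare : EReal) ≤ (C a : EReal) * I.utility U := by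
  obtain ⟨T, hT⟩ := RealRAM.isPoly_trySingletonBound.forBound.add
    ((RealRAM.IsPoly.bound (.queryValue 3 6 (.const 0))).add
      RealRAM.isPoly_tryGuessBound.forBound)
  -- The value at `0` only serves positivity of the factor for every real `a`, since `188 / 0 = 0`.
  refine ⟨RealRAM.algorithm, T, fun a => if a = 0 then 1 else 188 / a ^ 2, by norm_num,
    fun a => ?_, fun a ha ha1 n I hf D hD => ?_⟩
  · dsimp only
    split_ifs with h
    · exact one_pos
    · positivity
  obtain ⟨t, s, hexec, ht, hfeas, hle⟩ := RealRAM.halts_algorithm hf ha ha1 hD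
  refine ⟨s.agents n 0, ⟨t, s, hexec, ht.trans_eq (hT n).symm, rfl⟩, hfeas, ?_⟩
  dsimp only
  rw [if_neg ha.ne', hfeas.utility_eq, ← EReal.coe_mul]
  exact EReal.coe_le_coe_iff.2 hle
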